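/- Let $\lambda,u,s>0$ and $0<c\le u$. A file is updated at a source with i.i.d. exponential inter-update times of rate $\lambda$. A user, whose copy is fresh at time $0$, requests the file with i.i.d. exponential inter-request times of rate $u$. The file is not cached: the cache forwards each request to the source, immediately and independently of everything else, with probability $c/u$. The user's copy becomes outdated at the first source update after it was received. The first request that reaches the source after that moment starts a transmission of the file from the source to the user, and requests reaching the source at other times have no effect. A transmission attempt takes an exponential time of rate $s$; if the source updates the file during the attempt, the attempt is interrupted and a new attempt, with a new independent exponential time of rate $s$, starts at once with the fresh version, until an attempt is completed. This completion is a successful update and makes the user's copy fresh. All the inter-update times, inter-request times, forwarding decisions and transmission times are mutually independent. Put $f_u(t)=1$ if the user's copy is fresh at time $t$ and $f_u(t)=0$ otherwise. With time $0$ counted as the $0$th successful update, let $I_j$ be the time between the $j$th and the $(j+1)$th successful updates, and let $T_j$ be the time during which the copy is fresh in that cycle. Then for every $j\ge 0$ the variables $T_j$ and $I_j$ are integrable with $$\mathbb{E}[T_j]=\frac1\lambda,\qquad \mathbb{E}[I_j]=\frac1\lambda+\frac1c+\frac1s,$$ and the long-term average freshness of the file at the user exists almost surely and equals $$\lim_{T\to\infty}\frac1T\int_0^T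 f_u(t)\,dt=\frac{\mathbb{E}[T_j]}{\mathbb{E}[I_j]}=\frac{c}{c+\lambda+\frac{c\lambda}{s}} .$$ -/

import Mathlib

open MeasureTheory ProbabilityTheory Filter Topology

noncomputable section

namespace CacheUpdating

/-- One realization of the exogenous randomness that concerns a single uncached file. -/
structure Path where
  /-- inter-update times of the file at the source -/
  update : ℕ → ℝ
  /-- inter-request times of the user for the file -/
  request : ℕ → ℝ
  /-- whether the cache forwards the `n`-th request of the user to the source -/
  forwarded : ℕ → Prop
  /-- `transmission j m` is the time that the `m`-th transmission attempt of the `j`-th update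
  cycle takes if it is not interrupted -/
  transmission : ℕ → ℕ → ℝ

/-- The epoch of the `n`-th event of a point process with the given inter-event times. -/
def eventTime (gap : ℕ → ℝ) (n : ℕ) : ℝ := ∑ k ∈ Finset.range (n + 1), gap k

/-- The first point of `E` strictly after time `t`. -/
def nextAfter (E : Set ℝ) (t : ℝ) : ℝ := sInf {x | x ∈ E ∧ t < x}

namespace Path

variable (P : Path)

/-- The epochs at which the file is updated at the source. -/
def updateTimes : Set ℝ := {x | ∃ n, eventTime P.update n = x}

/-- The epochs at which a request of the user reaches the source, i.e. the epochs of the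
requests that the cache forwards. -/
def forwardedTimes : Set ℝ := {x | ∃ n, P.forwarded n ∧ eventTime P.request n = x}

/-- Start of the `m`-th transmission attempt when the first one starts at time `r`: an attempt
that is interrupted by an update at the source is replaced, at that moment, by a new attempt
with the fresh version. -/
def attemptStart (r : ℝ) : ℕ → ℝ
  | 0 => r
  | m + 1 => nextAfter P.updateTimes (attemptStart r m)

/-- The index of the attempt that succeeds in cycle `j`, if the first attempt starts at time `r`:
the first attempt that is completed before the next update at the source. -/
def lastAttempt (j : ℕ) (r : ℝ) : ℕ :=
  sInf {m | P.attemptStart r m + P.transmission j m < P.attemptStart r (m + 1)}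

/-- The time at which the file is delivered to the user in cycle `j`, if the first transmission
attempt starts at time `r`. -/
def deliveryTime (j : ℕ) (r : ℝ) : ℝ :=
  P.attemptStart r (P.lastAttempt j r) + P.transmission j (P.lastAttempt j r)

/-- The time of the `j`-th successful update at the user (the user starts with a fresh file at
time `0`). The file becomes outdated at the first update at the source after that; the first
request that reaches the source later on starts the transmission; the next successful update
is the end of the transmission. -/
def successTime : ℕ → ℝ
  | 0 => 0
  | j + 1 => P.deliveryTime j
      (nextAfter P.forwardedTimes (nextAfter P.updateTimes (successTime j)))

/-- The file at the user is fresh at time `t`: some successful update has taken place by time `t`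
and the source has not updated the file since. -/
def IsFresh (t : ℝ) : Prop :=
  ∃ j, P.successTime j ≤ t ∧ ∀ x ∈ P.updateTimes, ¬ (P.successTime j < x ∧ x ≤ t)

open Classical in
/-- The instantaneous freshness function of the file at the user. -/
def freshness (t : ℝ) : ℝ := if P.IsFresh t then 1 else 0

/-- The length of the `j`-th update cycle. -/
def cycleLength (j : ℕ) : ℝ := P.successTime (j + 1) - P.successTime j

/-- The time during which the file at the user is fresh in the `j`-th update cycle. -/
def freshDuration (j : ℕ) : ℝ :=
  ∫ t in (P.successTime j)..(P.successTime (j + 1)), P.freshness t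

end Path

/-- The realization belonging to the outcome `ω`, for random inter-update times `A`, inter-request
times `B`, forwarding events `D` and transmission times `S`. -/
def path {Ω : Type*} (A B : ℕ → Ω → ℝ) (D : ℕ → Set Ω) (S : ℕ → ℕ → Ω → ℝ) (ω : Ω) : Path where
  update n := A n ω
  request n := B n ω
  forwarded n := ω ∈ D n
  transmission j m := S j m ω

end CacheUpdating

end

open CacheUpdating

/-!
The delivery of the file starts the process afresh. Seen from the beginning of a cycle, the future
consists of the gaps between the updates, the gaps and marks of the requests, and the transmission
times that have not been used (`Future`). A cycle has three phases: the copy is fresh until the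
first update (`freshPhase`), it waits until the next forwarded request (`waitPhase`), and the
transmission takes some time, interrupted attempts included (`sendPhase`); then `Future.next` is
what lies ahead. The heart of the proof is `measurePreserving_cycle`: if the future has the law
`futureLaw` of independent exponential gaps and independent marks, then so has `Future.next`, and
it is independent of the three phases, which are independent of each other. Hence any function of
the phases is pairwise independent and identically distributed over the cycles.

The regeneration rests on memorylessness. When a clock of exponential gaps is stopped inside one of
its gaps, at a level that is determined by the earlier gaps and by independent variables, the
`residual` gaps are again independent exponential variables, independent of the past
(`measurePreserving_stopped`). This is applied to the updates while a request is awaited, to the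
requests while an update or a delivery is awaited, and to the updates during the attempts, where
the level is the transmission time of the attempt. The marks are stopped at the first forwarded
request (`measurePreserving_forward`).

The fresh phase is exponential with mean `1 / lam`. The means of the two other phases are geometric
series, over the requests up to the first forwarded one (`lintegral_forwardDelay`, sum `1 / c`) and
over the attempts up to the successful one (`lintegral_transmissionDelay`, sum `1 / s`).

For a single realization, `Future.Governs.cycle` identifies the recursion for the successful updates
with the iteration of `Future.next`, and `Future.isFresh_iff` says that within a cycle the copy is
fresh exactly during the first phase. The strong law of large numbers for the fresh phases and for
the cycle lengths gives the limit by the renewal reward argument (`tendsto_renewal_reward`).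
-/

open scoped ENNReal

namespace CacheUpdating

/-! ### The exponential distribution -/

theorem expMeasure_eq_withDensity (r : ℝ) :
    expMeasure r = volume.withDensity (exponentialPDF r) := rfl

theorem measurable_exponentialPDF (r : ℝ) : Measurable (exponentialPDF r) :=
  (measurable_exponentialPDFReal r).ennreal_ofReal

theorem expMeasure_Iic_zero (r : ℝ) : expMeasure r (Set.Iic 0) = 0 := by
  rw [expMeasure_eq_withDensity, withDensity_apply _ measurableSet_Iic,
    setLIntegral_congr Iio_ae_eq_Iic.symm]
  exact lintegral_exponentialPDF_of_nonpos le_rfl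

theorem expMeasure_ae_pos (r : ℝ) : ∀ᵐ x ∂expMeasure r, 0 < x := by
  rw [ae_iff]
  convert expMeasure_Iic_zero r using 2
  ext x
  simp

/-- Memorylessness: beyond a level `t ≥ 0` the exponential distribution looks like itself. -/
theorem expMeasure_memoryless {r t : ℝ} (ht : 0 ≤ t) {E : Set ℝ} (hE : MeasurableSet E) :
    expMeasure r {x | t < x ∧ x - t ∈ E} =
      ENNReal.ofReal (Real.exp (-(r * t))) * expMeasure r E := by
  have hpos : expMeasure r E = expMeasure r (E ∩ Set.Ioi 0) := by
    refine measure_congr ?_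
    filter_upwards [expMeasure_ae_pos r] with x hx
    exact propext ⟨fun h => ⟨h, hx⟩, fun h => h.1⟩
  have hS : MeasurableSet {x : ℝ | t < x ∧ x - t ∈ E} :=
    measurableSet_Ioi.inter (hE.preimage (measurable_id.sub_const t))
  rw [hpos, expMeasure_eq_withDensity, withDensity_apply _ hS,
    withDensity_apply _ (hE.inter measurableSet_Ioi), ← lintegral_indicator hS,
    ← lintegral_indicator (hE.inter measurableSet_Ioi),
    ← lintegral_const_mul _ ((measurable_exponentialPDF r).indicator (hE.inter measurableSet_Ioi)),
    ← lintegral_add_right_eq_self _ t]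
  refine lintegral_congr fun x => ?_
  by_cases hx : x ∈ E ∩ Set.Ioi 0
  · have h1 : x + t ∈ {x : ℝ | t < x ∧ x - t ∈ E} := by
      simpa using ⟨hx.2, hx.1⟩
    have hx0 : (0 : ℝ) < x := hx.2
    rw [Set.indicator_of_mem h1, Set.indicator_of_mem hx,
      exponentialPDF_of_nonneg (by linarith), exponentialPDF_of_nonneg hx0.le,
      ← ENNReal.ofReal_mul (Real.exp_pos _).le]
    congr 1
    rw [show -(r * (x + t)) = -(r * t) + -(r * x) by ring, Real.exp_add]
    ring
  · have h1 : x + t ∉ {x : ℝ | t < x ∧ x - t ∈ E} := by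
      intro h
      apply hx
      simpa [and_comm] using h
    rw [Set.indicator_of_notMem h1, Set.indicator_of_notMem hx, mul_zero]

theorem expMeasure_Ioi {r t : ℝ} (hr : 0 < r) (ht : 0 ≤ t) :
    expMeasure r (Set.Ioi t) = ENNReal.ofReal (Real.exp (-(r * t))) := by
  have := isProbabilityMeasure_expMeasure hr
  simpa using! expMeasure_memoryless (r := r) ht MeasurableSet.univ

theorem expMeasure_Ioi_ne_zero {r : ℝ} (hr : 0 < r) {t : ℝ} (ht : 0 ≤ t) :
    expMeasure r (Set.Ioi t) ≠ 0 := by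
  rw [expMeasure_Ioi hr ht]
  simpa using Real.exp_pos _

/-- The mean of the exponential distribution. -/
theorem lintegral_expMeasure {r : ℝ} (hr : 0 < r) :
    ∫⁻ x, ENNReal.ofReal x ∂expMeasure r = ENNReal.ofReal (1 / r) := by
  rw [expMeasure_eq_withDensity,
    lintegral_withDensity_eq_lintegral_mul _ (measurable_exponentialPDF r)
      ENNReal.measurable_ofReal]
  have hI : ∫ x in Set.Ioi (0 : ℝ), x ^ ((2 : ℝ) - 1) * Real.exp (-(r * x)) =
      (1 / r) ^ (2 : ℝ) := by
    rw [Real.integral_rpow_mul_exp_neg_mul_Ioi two_pos hr, Real.Gamma_two, mul_one]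
  have hne : ∫ x in Set.Ioi (0 : ℝ), x ^ ((2 : ℝ) - 1) * Real.exp (-(r * x)) ≠ 0 := by
    rw [hI]; positivity
  have hint : IntegrableOn (fun x : ℝ => x ^ ((2 : ℝ) - 1) * Real.exp (-(r * x))) (Set.Ioi 0) :=
    not_imp_comm.1 integral_undef hne
  have hpt : ∀ x : ℝ, (exponentialPDF r * fun x => ENNReal.ofReal x) x =
      (Set.Ioi (0 : ℝ)).indicator
        (fun x => ENNReal.ofReal (r * (x ^ ((2 : ℝ) - 1) * Real.exp (-(r * x))))) x := by
    intro x
    by_cases hx : 0 < x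
    · rw [Set.indicator_of_mem (Set.mem_Ioi.2 hx), Pi.mul_apply, exponentialPDF_of_nonneg hx.le,
        ← ENNReal.ofReal_mul (by positivity)]
      congr 1
      rw [show (2 : ℝ) - 1 = 1 by norm_num, Real.rpow_one]
      ring
    · rw [Set.indicator_of_notMem (by simpa using hx), Pi.mul_apply,
        ENNReal.ofReal_of_nonpos (not_lt.1 hx), mul_zero]
  rw [lintegral_congr hpt, lintegral_indicator measurableSet_Ioi,
    ← ofReal_integral_eq_lintegral_ofReal (hint.const_mul r), integral_const_mul, hI]
  · congr 1
    rw [Real.rpow_two]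
    field_simp
  · filter_upwards [self_mem_ae_restrict measurableSet_Ioi] with x hx
    have hx' : (0 : ℝ) < x := hx
    positivity

/-- The Laplace transform of the exponential distribution. -/
theorem lintegral_exp_neg_expMeasure {r l : ℝ} (hr : 0 < r) (hl : 0 < l) :
    ∫⁻ x, ENNReal.ofReal (Real.exp (-(l * x))) ∂expMeasure r = ENNReal.ofReal (r / (l + r)) := by
  rw [expMeasure_eq_withDensity,
    lintegral_withDensity_eq_lintegral_mul _ (measurable_exponentialPDF r) (by fun_prop)]
  have hpt : ∀ x : ℝ, (exponentialPDF r * fun x => ENNReal.ofReal (Real.exp (-(l * x)))) x =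
      ENNReal.ofReal (r / (l + r)) * exponentialPDF (l + r) x := by
    intro x
    rw [Pi.mul_apply]
    by_cases hx : 0 ≤ x
    · rw [exponentialPDF_of_nonneg hx, exponentialPDF_of_nonneg hx,
        ← ENNReal.ofReal_mul (by positivity), ← ENNReal.ofReal_mul (by positivity)]
      congr 1
      rw [show -((l + r) * x) = -(r * x) + -(l * x) by ring, Real.exp_add]
      field_simp
    · rw [exponentialPDF_of_neg (not_le.1 hx), exponentialPDF_of_neg (not_le.1 hx), zero_mul,
        mul_zero]
  rw [lintegral_congr hpt, lintegral_const_mul _ (measurable_exponentialPDF _),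
    lintegral_exponentialPDF_eq_one (by positivity), mul_one]

/-- The mean of the minimum of an exponential variable and a constant: by memorylessness, the part
beyond the constant has mean `exp (-(r * t))` times the full mean. -/
theorem lintegral_min_expMeasure {r t : ℝ} (hr : 0 < r) (ht : 0 ≤ t) :
    ∫⁻ x, ENNReal.ofReal (min x t) ∂expMeasure r =
      ENNReal.ofReal (1 / r) * ENNReal.ofReal (1 - Real.exp (-(r * t))) := by
  have := isProbabilityMeasure_expMeasure hr
  have hmap : Measure.map (fun x => x - t) ((expMeasure r).restrict (Set.Ioi t)) =
      ENNReal.ofReal (Real.exp (-(r * t))) • expMeasure r := by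
    ext E hE
    rw [Measure.map_apply (by fun_prop) hE,
      Measure.restrict_apply (hE.preimage (by fun_prop)), Measure.smul_apply, smul_eq_mul,
      ← expMeasure_memoryless ht hE]
    congr 1
    ext x
    simp [and_comm]
  -- The mean of the excess over `t`.
  have hover : ∫⁻ x, ENNReal.ofReal (x - t) ∂expMeasure r =
      ENNReal.ofReal (Real.exp (-(r * t))) * ENNReal.ofReal (1 / r) := by
    have h1 : ∫⁻ x, ENNReal.ofReal (x - t) ∂expMeasure r =
        ∫⁻ x in Set.Ioi t, ENNReal.ofReal (x - t) ∂expMeasure r := by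
      rw [← lintegral_indicator measurableSet_Ioi]
      refine lintegral_congr fun x => ?_
      by_cases hx : t < x
      · rw [Set.indicator_of_mem (Set.mem_Ioi.2 hx)]
      · rw [Set.indicator_of_notMem (by simpa using hx), ENNReal.ofReal_of_nonpos (by linarith)]
    rw [h1, ← lintegral_map (f := fun x => ENNReal.ofReal x) (by fun_prop)
      (g := fun x => x - t) (by fun_prop), hmap, lintegral_smul_measure, lintegral_expMeasure hr,
      smul_eq_mul]
  have hsum : ∫⁻ x, ENNReal.ofReal (min x t) ∂expMeasure r +
      ENNReal.ofReal (Real.exp (-(r * t))) * ENNReal.ofReal (1 / r) = ENNReal.ofReal (1 / r) := by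
    rw [← hover, ← lintegral_add_left (by fun_prop), ← lintegral_expMeasure hr]
    refine lintegral_congr_ae ?_
    filter_upwards [expMeasure_ae_pos r] with x hx
    rcases le_total x t with h | h
    · rw [min_eq_left h, ENNReal.ofReal_of_nonpos (sub_nonpos.2 h), add_zero]
    · rw [min_eq_right h, ← ENNReal.ofReal_add ht (sub_nonneg.2 h)]
      congr 1; ring
  have hle : Real.exp (-(r * t)) ≤ 1 := Real.exp_le_one_iff.2 (by nlinarith)
  have hfin : ENNReal.ofReal (Real.exp (-(r * t))) * ENNReal.ofReal (1 / r) ≠ ∞ := by finiteness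
  refine (ENNReal.add_left_inj hfin).1 ?_
  rw [hsum, ← ENNReal.ofReal_mul (by positivity), ← ENNReal.ofReal_mul (by positivity),
    ← ENNReal.ofReal_add (mul_nonneg (by positivity) (by linarith)) (by positivity)]
  congr 1; ring

/-! ### Sequences of independent identically distributed variables -/

section Sequences

variable {E : Type*}

/-- The sequence without its first `n` terms. -/
def shift (n : ℕ) (x : ℕ → E) : ℕ → E := fun i => x (n + i)

/-- The sequence that starts with the first `n` terms of `p` and goes on with `x`. -/
def glue (n : ℕ) (p x : ℕ → E) : ℕ → E := fun i => if i < n then p i else x (i - n)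

/-- The sequence that starts with `a` and goes on with `x`. -/
def cons (a : E) (x : ℕ → E) : ℕ → E := fun i => if i = 0 then a else x (i - 1)

@[simp] theorem shift_apply (n : ℕ) (x : ℕ → E) (i : ℕ) : shift n x i = x (n + i) := rfl

@[simp] theorem shift_glue (n : ℕ) (p x : ℕ → E) : shift n (glue n p x) = x := by
  ext i; simp [glue]

theorem glue_of_lt {n i : ℕ} (h : i < n) (p x : ℕ → E) : glue n p x i = p i := if_pos h

@[simp] theorem glue_add (n k : ℕ) (p x : ℕ → E) : glue n p x (n + k) = x k := by
  simp [glue]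

@[simp] theorem glue_self (n : ℕ) (p x : ℕ → E) : glue n p x n = x 0 := by
  simp [glue]

@[simp] theorem shift_succ_glue (n : ℕ) (p x : ℕ → E) :
    shift (n + 1) (glue n p x) = shift 1 x := by
  ext i; simp [add_assoc]

@[simp] theorem cons_zero (a : E) (x : ℕ → E) : cons a x 0 = a := rfl

@[simp] theorem cons_succ (a : E) (x : ℕ → E) (i : ℕ) : cons a x (i + 1) = x i := by simp [cons]

variable [MeasurableSpace E]

@[fun_prop] theorem measurable_shift (n : ℕ) : Measurable (shift (E := E) n) :=
  measurable_pi_lambda _ fun _ => measurable_pi_apply _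

@[fun_prop] theorem measurable_glue (n : ℕ) :
    Measurable fun q : (ℕ → E) × (ℕ → E) => glue n q.1 q.2 := by
  refine measurable_pi_lambda _ fun i => ?_
  by_cases h : i < n
  · simp only [glue, h, if_true]; fun_prop
  · simp only [glue, h, if_false]; fun_prop

@[fun_prop] theorem measurable_cons : Measurable fun q : E × (ℕ → E) => cons q.1 q.2 := by
  refine measurable_pi_lambda _ fun i => ?_
  by_cases h : i = 0
  · simpa [cons, h] using measurable_fst
  · simp only [cons, h, if_false]; fun_prop

/-- The law of a sequence of independent variables with common law `π`. -/
noncomputable abbrev iidLaw (π : Measure E) [IsProbabilityMeasure π] : Measure (ℕ → E) :=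
  Measure.infinitePi fun _ => π

variable (π : Measure E) [IsProbabilityMeasure π]

theorem measurePreserving_glue (n : ℕ) :
    MeasurePreserving (fun q : (ℕ → E) × (ℕ → E) => glue n q.1 q.2)
      ((iidLaw π).prod (iidLaw π)) (iidLaw π) := by
  refine ⟨measurable_glue n, Measure.eq_infinitePi _ fun s t ht => ?_⟩
  classical
  have hpre : (fun q : (ℕ → E) × (ℕ → E) => glue n q.1 q.2) ⁻¹' (Set.pi s t) =
      (Set.pi (s.filter (· < n)) t) ×ˢ
        (Set.pi ((s.filter (n ≤ ·)).image (· - n)) fun i => t (n + i)) := by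
    ext ⟨p, x⟩
    simp only [Set.mem_preimage, Set.mem_pi, Finset.mem_coe, Set.mem_prod, Finset.mem_filter,
      Finset.mem_image]
    constructor
    · intro h
      refine ⟨fun i hi => ?_, ?_⟩
      · simpa [glue_of_lt hi.2] using h i hi.1
      · rintro _ ⟨i, hi, rfl⟩
        simpa [glue, hi.2, not_lt.2 hi.2] using h i hi.1
    · rintro ⟨h1, h2⟩ i hi
      rcases lt_or_ge i n with h | h
      · rw [glue_of_lt h]; exact h1 i ⟨hi, h⟩
      · have := h2 (i - n) ⟨i, ⟨hi, h⟩, rfl⟩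
        simpa [glue, h, not_lt.2 h] using this
  rw [Measure.map_apply (measurable_glue n) (.pi s.countable_toSet fun _ _ => ht _), hpre,
    Measure.prod_prod, Measure.infinitePi_pi _ (fun _ _ => ht _),
    Measure.infinitePi_pi _ (fun _ _ => ht _),
    Finset.prod_image, ← Finset.prod_filter_mul_prod_filter_not s (· < n)]
  · congr 1
    have hf : s.filter (fun i => ¬ i < n) = s.filter (n ≤ ·) := by simp
    rw [hf]
    refine Finset.prod_congr rfl fun i hi => ?_
    rw [Nat.add_sub_cancel' (Finset.mem_filter.1 hi).2]
  · intro a ha b hb hab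
    have h1 := (Finset.mem_filter.1 ha).2
    have h2 := (Finset.mem_filter.1 hb).2
    simp only at hab
    omega

theorem measurePreserving_cons :
    MeasurePreserving (fun q : E × (ℕ → E) => cons q.1 q.2) (π.prod (iidLaw π)) (iidLaw π) := by
  have h1 : MeasurePreserving (Prod.map (fun p : ℕ → E => p 0) id)
      ((iidLaw π).prod (iidLaw π)) (π.prod (iidLaw π)) :=
    (measurePreserving_eval_infinitePi (fun _ => π) 0).prod (.id _)
  refine ⟨measurable_cons, ?_⟩
  rw [← h1.map_eq, Measure.map_map measurable_cons h1.measurable]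
  refine Eq.trans ?_ (measurePreserving_glue π 1).map_eq
  congr 1
  ext q i
  rcases i with _ | i <;> simp [glue, cons]

theorem measurePreserving_head_tail :
    MeasurePreserving (fun x : ℕ → E => (x 0, shift 1 x)) (iidLaw π) (π.prod (iidLaw π)) := by
  refine ⟨by fun_prop, ?_⟩
  conv_lhs => rw [← (measurePreserving_cons π).map_eq]
  rw [Measure.map_map (by fun_prop) measurable_cons]
  convert Measure.map_id
  ext q i
  · rfl
  · simp [add_comm 1]

theorem measurePreserving_shift (n : ℕ) :
    MeasurePreserving (shift n) (iidLaw π) (iidLaw π) := by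
  refine ⟨by fun_prop, ?_⟩
  conv_lhs => rw [← (measurePreserving_glue π n).map_eq]
  rw [Measure.map_map (by fun_prop) (by fun_prop)]
  have : shift n ∘ (fun q : (ℕ → E) × (ℕ → E) => glue n q.1 q.2) = Prod.snd := by
    ext q i; simp
  rw [this]
  exact measurePreserving_snd.map_eq

/-- The part of an i.i.d. sequence from index `n` on is i.i.d. with the same law and independent of
any quantity that is determined by the first `n` terms. -/
theorem measurePreserving_shift_right {Y : Type*} [MeasurableSpace Y] {n : ℕ} {f : (ℕ → E) → Y}
    (hf : Measurable f) (hfn : ∀ p x, f (glue n p x) = f p) :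
    MeasurePreserving (fun x => (f x, shift n x)) (iidLaw π)
      (((iidLaw π).map f).prod (iidLaw π)) := by
  refine ⟨by fun_prop, ?_⟩
  conv_lhs => rw [← (measurePreserving_glue π n).map_eq]
  rw [Measure.map_map (by fun_prop) (by fun_prop)]
  have h : MeasurePreserving (Prod.map f id) ((iidLaw π).prod (iidLaw π))
      (((iidLaw π).map f).prod (iidLaw π)) :=
    MeasurePreserving.prod ⟨hf, rfl⟩ (.id _)
  rw [← h.map_eq]
  congr 1
  ext q <;> simp [hfn]

/-- An event of positive probability happens infinitely often. -/
theorem ae_frequently_mem {A : Set E} (hA : MeasurableSet A) (h0 : π A ≠ 0) :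
    ∀ᵐ x ∂iidLaw π, ∃ᶠ n in atTop, x n ∈ A := by
  have hex : ∀ᵐ x ∂iidLaw π, ∃ n, x n ∈ A := by
    have hle : ∀ k : ℕ, iidLaw π {x | ∀ n, x n ∉ A} ≤ (π Aᶜ) ^ k := by
      intro k
      calc iidLaw π {x | ∀ n, x n ∉ A} ≤ iidLaw π (Set.pi (Finset.range k) fun _ => Aᶜ) :=
            measure_mono fun x hx i _ => hx i
        _ = (π Aᶜ) ^ k := by
            rw [Measure.infinitePi_pi _ fun _ _ => hA.compl]; simp
    have hlt : π Aᶜ < 1 := by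
      rw [prob_compl_eq_one_sub hA]
      exact ENNReal.sub_lt_self ENNReal.one_ne_top one_ne_zero h0
    have h := ge_of_tendsto' (ENNReal.tendsto_pow_atTop_nhds_zero_of_lt_one hlt) hle
    rw [ae_iff]
    simpa using! h
  have hall : ∀ᵐ x ∂iidLaw π, ∀ k, ∃ n, shift k x n ∈ A :=
    ae_all_iff.2 fun k => (measurePreserving_shift π k).quasiMeasurePreserving.ae hex
  filter_upwards [hall] with x hx
  rw [frequently_atTop]
  intro k
  obtain ⟨n, hn⟩ := hx k
  exact ⟨k + n, Nat.le_add_right _ _, hn⟩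

end Sequences

/-! ### Measurability of random indices -/

theorem measurable_sInf_nat {V : Type*} [MeasurableSpace V] {p : V → ℕ → Prop}
    (hp : ∀ n, MeasurableSet {v | p v n}) : Measurable fun v => sInf {n | p v n} := by
  refine measurable_to_countable' fun k => ?_
  have hset : (fun v => sInf {n | p v n}) ⁻¹' {k} =
      ({v | p v k} ∩ ⋂ i ∈ Set.Iio k, {v | p v i}ᶜ) ∪
        {v | (∀ n, v ∈ {v | p v n}ᶜ) ∧ k = 0} := by
    ext v
    simp only [Set.mem_preimage, Set.mem_singleton_iff, Set.mem_union, Set.mem_inter_iff,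
      Set.mem_ofPred_eq, Set.mem_iInter, Set.mem_compl_iff, Set.mem_Iio]
    constructor
    · rintro rfl
      by_cases h : ∃ n, p v n
      · exact Or.inl ⟨Nat.sInf_mem (s := {n | p v n}) h, fun i hi => Nat.notMem_of_lt_sInf hi⟩
      · push Not at h
        refine Or.inr ⟨h, ?_⟩
        simp [h]
    · rintro (⟨h1, h2⟩ | ⟨h1, rfl⟩)
      · refine le_antisymm (Nat.sInf_le h1) ?_
        by_contra hlt
        exact h2 _ (not_le.1 hlt) (Nat.sInf_mem (s := {n | p v n}) ⟨k, h1⟩)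
      · simp [h1]
  rw [hset]
  refine ((hp k).inter (.biInter (Set.to_countable _) fun i _ => (hp i).compl)).union ?_
  by_cases hk : k = 0
  · simp only [hk, and_true, Set.ofPred_forall]
    exact .iInter fun n => (hp n).compl
  · simp [hk]

theorem measurable_apply_index {E V : Type*} [MeasurableSpace E] [MeasurableSpace V]
    {N : V → ℕ} {x : V → ℕ → E} (hN : Measurable N) (hx : Measurable x) :
    Measurable fun v => x v (N v) := by
  have h : Measurable fun q : (ℕ → E) × ℕ => q.1 q.2 :=
    measurable_from_prod_countable_left fun n => measurable_pi_apply n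
  exact h.comp (hx.prodMk hN)

@[fun_prop] theorem measurable_shift_index {E V : Type*} [MeasurableSpace E] [MeasurableSpace V]
    {N : V → ℕ} {x : V → ℕ → E} (hN : Measurable N) (hx : Measurable x) :
    Measurable fun v => shift (N v) (x v) :=
  measurable_pi_lambda _ fun i =>
    measurable_apply_index (N := fun v => N v + i) (hN.add_const i) hx

theorem measure_eq_tsum_index {V : Type*} [MeasurableSpace V] (m : Measure V) {N : V → ℕ}
    (hN : Measurable N) {A : Set V} (hA : MeasurableSet A) :
    m A = ∑' n, m (A ∩ {v | N v = n}) := by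
  rw [← measure_iUnion]
  · congr 1
    ext v; simp
  · intro i j hij
    refine Set.disjoint_left.2 fun v hi hj => hij ?_
    rw [← hi.2, ← hj.2]
  · exact fun n => hA.inter (hN (measurableSet_singleton n))

/-! ### Partial sums and the residual sequence of gaps -/

/-- The sum of the first `n` gaps. -/
def partialSum (x : ℕ → ℝ) (n : ℕ) : ℝ := ∑ i ∈ Finset.range n, x i

@[simp] theorem partialSum_zero (x : ℕ → ℝ) : partialSum x 0 = 0 := rfl

theorem partialSum_succ (x : ℕ → ℝ) (n : ℕ) : partialSum x (n + 1) = partialSum x n + x n :=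
  Finset.sum_range_succ _ _

theorem partialSum_add (x : ℕ → ℝ) (n k : ℕ) :
    partialSum x (n + k) = partialSum x n + partialSum (shift n x) k :=
  Finset.sum_range_add _ _ _

theorem partialSum_glue (n : ℕ) (p x : ℕ → ℝ) : partialSum (glue n p x) n = partialSum p n :=
  Finset.sum_congr rfl fun _ hi => glue_of_lt (Finset.mem_range.1 hi) _ _

theorem partialSum_mono {x : ℕ → ℝ} (hx : ∀ n, 0 < x n) : StrictMono (partialSum x) :=
  strictMono_nat_of_lt_succ fun n => by rw [partialSum_succ]; linarith [hx n]

@[fun_prop] theorem measurable_partialSum (n : ℕ) : Measurable fun x => partialSum x n := by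
  unfold partialSum; fun_prop

@[fun_prop] theorem measurable_partialSum_index {V : Type*} [MeasurableSpace V]
    {N : V → ℕ} {x : V → ℕ → ℝ} (hN : Measurable N) (hx : Measurable x) :
    Measurable fun v => partialSum (x v) (N v) := by
  have h : Measurable fun v n => partialSum (x v) n := by
    refine measurable_pi_lambda _ fun n => ?_
    fun_prop
  exact measurable_apply_index hN h

/-- The index of the gap that contains the time `t ≥ 0`. An event at time `t` itself counts as past,
in accordance with the strict inequality in `nextAfter`. -/
noncomputable def crossIdx (x : ℕ → ℝ) (t : ℝ) : ℕ := sInf {n | t < partialSum x (n + 1)}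

/-- The gaps between the events after time `t`, counted from time `t` on. -/
noncomputable def residual (t : ℝ) (x : ℕ → ℝ) : ℕ → ℝ :=
  cons (partialSum x (crossIdx x t + 1) - t) (shift (crossIdx x t + 1) x)

@[fun_prop] theorem measurable_crossIdx {V : Type*} [MeasurableSpace V] {x : V → ℕ → ℝ} {t : V → ℝ}
    (hx : Measurable x) (ht : Measurable t) : Measurable fun v => crossIdx (x v) (t v) :=
  measurable_sInf_nat fun n =>
    measurableSet_lt ht ((measurable_partialSum (n + 1)).comp hx)

@[fun_prop] theorem measurable_residual {V : Type*} [MeasurableSpace V] {x : V → ℕ → ℝ} {t : V → ℝ}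
    (hx : Measurable x) (ht : Measurable t) : Measurable fun v => residual (t v) (x v) := by
  unfold residual
  have h : Measurable fun v => (partialSum (x v) (crossIdx (x v) (t v) + 1) - t v,
      shift (crossIdx (x v) (t v) + 1) (x v)) := by
    refine Measurable.prodMk (Measurable.sub ?_ ht) ?_
    · exact measurable_partialSum_index ((measurable_crossIdx hx ht).add_const 1) hx
    · exact measurable_shift_index ((measurable_crossIdx hx ht).add_const 1) hx
  exact measurable_cons.comp h

/-- Sequences of positive gaps whose events do not accumulate. -/
structure GoodGaps (x : ℕ → ℝ) : Prop where
  pos : ∀ n, 0 < x n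
  tendsto : Tendsto (partialSum x) atTop atTop

theorem GoodGaps.partialSum_nonneg {x : ℕ → ℝ} (hx : GoodGaps x) (n : ℕ) : 0 ≤ partialSum x n :=
  Finset.sum_nonneg fun i _ => (hx.pos i).le

theorem GoodGaps.lt_partialSum_crossIdx {x : ℕ → ℝ} (hx : GoodGaps x) (t : ℝ) :
    t < partialSum x (crossIdx x t + 1) := by
  refine Nat.sInf_mem (s := {n | t < partialSum x (n + 1)}) ?_
  obtain ⟨n, hn⟩ := ((tendsto_add_atTop_iff_nat 1).2 hx.tendsto |>.eventually_gt_atTop t).exists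
  exact ⟨n, hn⟩

theorem partialSum_crossIdx_le {x : ℕ → ℝ} {t : ℝ} (ht : 0 ≤ t) :
    partialSum x (crossIdx x t) ≤ t := by
  rcases h : crossIdx x t with _ | n
  · simpa using ht
  · by_contra hlt
    have := Nat.sInf_le (s := {n | t < partialSum x (n + 1)}) (not_le.1 hlt)
    rw [← crossIdx, h] at this
    omega

theorem crossIdx_eq {x : ℕ → ℝ} (hx : ∀ n, 0 < x n) {t : ℝ} {n : ℕ} (h1 : partialSum x n ≤ t)
    (h2 : t < partialSum x (n + 1)) : crossIdx x t = n := by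
  refine le_antisymm (Nat.sInf_le h2) ?_
  by_contra hlt
  have hmem : t < partialSum x (crossIdx x t + 1) :=
    Nat.sInf_mem (s := {n | t < partialSum x (n + 1)}) ⟨n, h2⟩
  have := (partialSum_mono hx).monotone (show crossIdx x t + 1 ≤ n by omega)
  linarith

/-! ### Exponential gaps are regenerated at stopping times -/

section Memoryless

variable {r : ℝ} [IsProbabilityMeasure (expMeasure r)]

/-- Memorylessness for the first gap of a sequence: its excess over `t` and the later gaps are fresh
and independent of the event that the gap exceeds `t`. -/
theorem iidLaw_exp_residual {t : ℝ} (ht : 0 ≤ t) {E : Set (ℕ → ℝ)} (hE : MeasurableSet E) :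
    iidLaw (expMeasure r) {x | t < x 0 ∧ cons (x 0 - t) (shift 1 x) ∈ E} =
      iidLaw (expMeasure r) {x | t < x 0} * iidLaw (expMeasure r) E := by
  have hc : Measurable fun q : (ℕ → ℝ) × ℝ => cons (q.2 - t) q.1 := by
    have : Measurable fun q : (ℕ → ℝ) × ℝ => (q.2 - t, q.1) := by fun_prop
    exact measurable_cons.comp this
  have hm : MeasurableSet {q : ℝ × (ℕ → ℝ) | t < q.1 ∧ cons (q.1 - t) q.2 ∈ E} :=
    (measurableSet_lt measurable_const measurable_fst).inter
      (hE.preimage (hc.comp measurable_swap))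
  have h1 : iidLaw (expMeasure r) {x | t < x 0 ∧ cons (x 0 - t) (shift 1 x) ∈ E} =
      ((expMeasure r).prod (iidLaw (expMeasure r)))
        {q | t < q.1 ∧ cons (q.1 - t) q.2 ∈ E} :=
    (measurePreserving_head_tail (expMeasure r)).measure_preimage hm.nullMeasurableSet
  have h2 : iidLaw (expMeasure r) {x | t < x 0} = expMeasure r (Set.Ioi t) :=
    (measurePreserving_eval_infinitePi (fun _ => expMeasure r) 0).measure_preimage
      measurableSet_Ioi.nullMeasurableSet
  have h3 : expMeasure r (Set.Ioi t) = ENNReal.ofReal (Real.exp (-(r * t))) := by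
    simpa using! expMeasure_memoryless (r := r) ht MeasurableSet.univ
  have hE' := hE.preimage (measurable_cons (E := ℝ))
  rw [h1, h2, h3, Measure.prod_apply_symm hm,
    ← (measurePreserving_cons (expMeasure r)).measure_preimage hE.nullMeasurableSet,
    Measure.prod_apply_symm hE', ← lintegral_const_mul _ (measurable_measure_prodMk_right hE')]
  refine lintegral_congr fun x => ?_
  have hx : MeasurableSet {a : ℝ | cons a x ∈ E} := by
    refine hE.preimage ?_
    have : Measurable fun a : ℝ => (a, x) := by fun_prop
    exact measurable_cons.comp this
  exact expMeasure_memoryless ht hx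

/-- If the gap in progress is long enough to exceed the level `τ` that is fixed by the previous
gaps, then its excess and the later gaps are fresh. -/
theorem measure_excess {W : Type*} [MeasurableSpace W] (ρ : Measure W) [IsProbabilityMeasure ρ]
    {n : ℕ} {H : Set (W × (ℕ → ℝ))} {τ : W × (ℕ → ℝ) → ℝ} (hH : MeasurableSet H)
    (hτ : Measurable τ) (hHn : ∀ w p x, (w, glue n p x) ∈ H ↔ (w, p) ∈ H)
    (hτn : ∀ w p x, τ (w, glue n p x) = τ (w, p)) (h0 : ∀ v ∈ H, 0 ≤ τ v)
    {E : Set (ℕ → ℝ)} (hE : MeasurableSet E) :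
    (ρ.prod (iidLaw (expMeasure r)))
      {v | v ∈ H ∧ τ v < v.2 n ∧ cons (v.2 n - τ v) (shift (n + 1) v.2) ∈ E} =
    (ρ.prod (iidLaw (expMeasure r))) {v | v ∈ H ∧ τ v < v.2 n} * iidLaw (expMeasure r) E := by
  set P := iidLaw (expMeasure r)
  have hmp : MeasurePreserving (fun q : (W × (ℕ → ℝ)) × (ℕ → ℝ) => (q.1.1, glue n q.1.2 q.2))
      ((ρ.prod P).prod P) (ρ.prod P) :=
    ((MeasurePreserving.id ρ).prod (measurePreserving_glue (expMeasure r) n)).comp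
      (measurePreserving_prodAssoc ρ P P)
  have hsec : ∀ F : Set (ℕ → ℝ), MeasurableSet F →
      (ρ.prod P) {v | v ∈ H ∧ τ v < v.2 n ∧ cons (v.2 n - τ v) (shift (n + 1) v.2) ∈ F} =
        ∫⁻ v, P {x | v ∈ H ∧ τ v < x 0 ∧ cons (x 0 - τ v) (shift 1 x) ∈ F} ∂(ρ.prod P) := by
    intro F hF
    have hm : MeasurableSet
        {v | v ∈ H ∧ τ v < v.2 n ∧ cons (v.2 n - τ v) (shift (n + 1) v.2) ∈ F} := by
      refine hH.inter ((measurableSet_lt hτ (by fun_prop)).inter (hF.preimage ?_))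
      have : Measurable fun v : W × (ℕ → ℝ) => (v.2 n - τ v, shift (n + 1) v.2) := by fun_prop
      exact measurable_cons.comp this
    rw [← hmp.measure_preimage hm.nullMeasurableSet,
      Measure.prod_apply (hm.preimage hmp.measurable)]
    refine lintegral_congr fun v => ?_
    congr 1
    ext x
    simp only [Set.mem_preimage, Set.mem_ofPred_eq, hHn, hτn, glue_self, shift_succ_glue]
  have huniv : (ρ.prod P) {v | v ∈ H ∧ τ v < v.2 n} =
      ∫⁻ v, P {x | v ∈ H ∧ τ v < x 0} ∂(ρ.prod P) := by
    simpa using hsec Set.univ .univ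
  rw [hsec E hE, huniv, ← lintegral_mul_const]
  · refine lintegral_congr fun v => ?_
    by_cases hv : v ∈ H
    · simpa [hv] using iidLaw_exp_residual (h0 v hv) hE
    · simp [hv]
  · have hm : MeasurableSet {q : (W × (ℕ → ℝ)) × (ℕ → ℝ) | q.1 ∈ H ∧ τ q.1 < q.2 0} :=
      (hH.preimage measurable_fst).inter (measurableSet_lt (hτ.comp measurable_fst)
        ((measurable_pi_apply 0).comp measurable_snd))
    exact measurable_measure_prodMk_left hm

/-- Strong memorylessness. The gap with index `N` is stopped at the level `τ N`, where the level and
the decision to stop depend on the previous gaps and on an independent variable `w` only. The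
excess and the later gaps then form a fresh sequence that is independent of everything that has been
observed up to the stopping time. -/
theorem measurePreserving_stopped {W Y : Type*} [MeasurableSpace W] [MeasurableSpace Y]
    (ρ : Measure W) [IsProbabilityMeasure ρ]
    {N : W × (ℕ → ℝ) → ℕ} {H : ℕ → Set (W × (ℕ → ℝ))} {τ : ℕ → W × (ℕ → ℝ) → ℝ}
    {κ : ℕ → W × (ℕ → ℝ) → Y} {e : W × (ℕ → ℝ) → Y} {R : W × (ℕ → ℝ) → ℕ → ℝ}
    (hN : Measurable N) (hH : ∀ n, MeasurableSet (H n)) (hτ : ∀ n, Measurable (τ n))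
    (hκ : ∀ n, Measurable (κ n)) (he : Measurable e) (hR : Measurable R)
    (hHn : ∀ n w p x, (w, glue n p x) ∈ H n ↔ (w, p) ∈ H n)
    (hτn : ∀ n w p x, τ n (w, glue n p x) = τ n (w, p))
    (hκn : ∀ n w p x, κ n (w, glue n p x) = κ n (w, p))
    (h0 : ∀ n, ∀ v ∈ H n, 0 ≤ τ n v)
    (hcond : ∀ᵐ v ∂ρ.prod (iidLaw (expMeasure r)), ∀ n, (N v = n ↔ v ∈ H n ∧ τ n v < v.2 n) ∧
      (N v = n → e v = κ n v ∧ R v = cons (v.2 n - τ n v) (shift (n + 1) v.2))) :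
    MeasurePreserving (fun v => (e v, R v)) (ρ.prod (iidLaw (expMeasure r)))
      (((ρ.prod (iidLaw (expMeasure r))).map e).prod (iidLaw (expMeasure r))) := by
  refine ⟨he.prodMk hR, (Measure.prod_eq fun B E hB hE => ?_).symm⟩
  have hprob := Measure.isProbabilityMeasure_map
    (μ := ρ.prod (iidLaw (expMeasure r))) he.aemeasurable
  rw [Measure.map_apply (he.prodMk hR) (hB.prod hE), Measure.map_apply he hB,
    measure_eq_tsum_index _ hN ((hB.prod hE).preimage (he.prodMk hR)),
    measure_eq_tsum_index _ hN (hB.preimage he), ← ENNReal.tsum_mul_right]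
  refine tsum_congr fun n => ?_
  have key := measure_excess (r := r) ρ (n := n) (H := H n ∩ κ n ⁻¹' B) (τ := τ n)
    ((hH n).inter (hB.preimage (hκ n))) (hτ n)
    (fun w p x => by simp [hHn, hκn]) (hτn n) (fun v hv => h0 n v hv.1) hE
  refine Eq.trans (measure_congr ?_) (key.trans (congrArg (· * _) (measure_congr ?_)))
  · filter_upwards [hcond] with v hv
    refine propext ?_
    constructor
    · rintro ⟨⟨h1, h2⟩, h3⟩
      obtain ⟨g1, g2⟩ := (hv n).2 h3
      obtain ⟨g3, g4⟩ := (hv n).1.1 h3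
      refine ⟨⟨g3, ?_⟩, g4, ?_⟩
      · rw [Set.mem_preimage, ← g1]; exact h1
      · rw [← g2]; exact h2
    · rintro ⟨⟨h1, h2⟩, h3, h4⟩
      have h5 := (hv n).1.2 ⟨h1, h3⟩
      obtain ⟨g1, g2⟩ := (hv n).2 h5
      refine ⟨⟨?_, ?_⟩, h5⟩
      · change e v ∈ B; rw [g1]; exact h2
      · change R v ∈ E; rw [g2]; exact h4
  · filter_upwards [hcond] with v hv
    refine propext ?_
    constructor
    · rintro ⟨⟨h1, h2⟩, h3⟩
      have h5 := (hv n).1.2 ⟨h1, h3⟩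
      refine ⟨?_, h5⟩
      change e v ∈ B; rw [((hv n).2 h5).1]; exact h2
    · rintro ⟨h1, h3⟩
      obtain ⟨g3, g4⟩ := (hv n).1.1 h3
      refine ⟨⟨g3, ?_⟩, g4⟩
      rw [Set.mem_preimage, ← ((hv n).2 h3).1]; exact h1

end Memoryless

/-- The gaps exceed `1` infinitely often, so their sum diverges. -/
theorem ae_goodGaps {r : ℝ} (hr : 0 < r) [IsProbabilityMeasure (expMeasure r)] :
    ∀ᵐ x ∂iidLaw (expMeasure r), GoodGaps x := by
  have hpos : ∀ᵐ x ∂iidLaw (expMeasure r), ∀ n, 0 < x n :=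
    ae_all_iff.2 fun n => (measurePreserving_eval_infinitePi (fun _ => expMeasure r)
      n).quasiMeasurePreserving.ae (expMeasure_ae_pos r)
  filter_upwards [hpos, ae_frequently_mem (expMeasure r) (measurableSet_Ioi (a := (1 : ℝ)))
    (expMeasure_Ioi_ne_zero hr zero_le_one)] with x hx hfreq
  refine ⟨hx, (not_summable_iff_tendsto_nat_atTop_of_nonneg fun n => (hx n).le).1 fun hsum => ?_⟩
  obtain ⟨n, h1, h2⟩ := (hfreq.and_eventually
    (hsum.tendsto_atTop_zero.eventually_lt_const one_pos)).exists
  exact lt_asymm h1 h2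

/-- The residual sequence at a fixed time is fresh: the clock is stopped in gap `n` at the level
`t - partialSum x n` if `partialSum x n ≤ t`. -/
theorem measurePreserving_residual {r : ℝ} (hr : 0 < r) [IsProbabilityMeasure (expMeasure r)]
    {t : ℝ} (ht : 0 ≤ t) :
    MeasurePreserving (residual t) (iidLaw (expMeasure r)) (iidLaw (expMeasure r)) := by
  set P := iidLaw (expMeasure r)
  -- The time `t` plays the role of the independent variable, with a Dirac law.
  have hmk : MeasurePreserving (Prod.mk t) P ((Measure.dirac t).prod P) :=
    ⟨by fun_prop, (Measure.dirac_prod t).symm⟩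
  have hgood : ∀ᵐ v ∂(Measure.dirac t).prod P, v.1 = t ∧ GoodGaps v.2 := by
    rw [← hmk.map_eq, (measurableEmbedding_prodMk_left t).ae_map_iff]
    filter_upwards [ae_goodGaps hr] with x hx using ⟨rfl, hx⟩
  have h := measurePreserving_stopped (r := r) (Measure.dirac t)
    (N := fun v => crossIdx v.2 v.1) (H := fun n => {v | 0 ≤ v.1 - partialSum v.2 n})
    (τ := fun n v => v.1 - partialSum v.2 n) (κ := fun _ v => v.1) (e := Prod.fst)
    (R := fun v => residual v.1 v.2) (by fun_prop)
    (fun n => measurableSet_le (by fun_prop) (by fun_prop)) (fun n => by fun_prop)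
    (fun n => by fun_prop) (by fun_prop) (by fun_prop) (fun n w p x => by simp [partialSum_glue])
    (fun n w p x => by simp [partialSum_glue]) (fun n w p x => rfl) (fun n v hv => hv) (by
      filter_upwards [hgood] with v ⟨hv, hx⟩ n
      refine ⟨⟨?_, ?_⟩, ?_⟩
      · rintro rfl
        have h1 := partialSum_crossIdx_le (x := v.2) (t := v.1) (hv ▸ ht)
        have h2 := hx.lt_partialSum_crossIdx v.1
        rw [partialSum_succ] at h2
        exact ⟨sub_nonneg.2 h1, by linarith⟩
      · rintro ⟨h1, h2⟩
        refine crossIdx_eq hx.pos (sub_nonneg.1 h1) ?_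
        rw [partialSum_succ]; linarith
      · rintro rfl
        refine ⟨rfl, ?_⟩
        rw [residual, partialSum_succ]
        congr 1; ring)
  have := Measure.isProbabilityMeasure_map
    (μ := (Measure.dirac t).prod P) (measurable_fst (α := ℝ) (β := ℕ → ℝ)).aemeasurable
  exact (measurePreserving_snd.comp h).comp hmk

/-! ### Rearranging products of measures -/

section Rearrange

variable {α β γ δ : Type*} [MeasurableSpace α] [MeasurableSpace β] [MeasurableSpace γ]
  [MeasurableSpace δ] (μa : Measure α) (μb : Measure β) (μc : Measure γ) (μd : Measure δ)
  [SFinite μb] [SFinite μc]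

theorem measurePreserving_assoc_symm :
    MeasurePreserving (fun p : α × (β × γ) => ((p.1, p.2.1), p.2.2))
      (μa.prod (μb.prod μc)) ((μa.prod μb).prod μc) :=
  (measurePreserving_prodAssoc μa μb μc).symm _

variable [SFinite μa]

theorem measurePreserving_left_comm :
    MeasurePreserving (fun p : α × (β × γ) => (p.2.1, (p.1, p.2.2)))
      (μa.prod (μb.prod μc)) (μb.prod (μa.prod μc)) :=
  (measurePreserving_prodAssoc μb μa μc).comp
    ((Measure.measurePreserving_swap.prod (.id μc)).comp (measurePreserving_assoc_symm μa μb μc))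

theorem measurePreserving_prod_comm [SFinite μd] :
    MeasurePreserving (fun p : (α × β) × (γ × δ) => ((p.1.1, p.2.1), (p.1.2, p.2.2)))
      ((μa.prod μb).prod (μc.prod μd)) ((μa.prod μc).prod (μb.prod μd)) :=
  (measurePreserving_assoc_symm μa μc (μb.prod μd)).comp
    (((MeasurePreserving.id μa).prod (measurePreserving_left_comm μb μc μd)).comp
      (measurePreserving_prodAssoc μa μb (μc.prod μd)))

end Rearrange

/-! ### The stream of requests -/

/-- The requests that lie ahead, as the pair of their gaps and their marks; a request is forwarded
if its mark is `1`. -/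
abbrev Requests := (ℕ → ℝ) × (ℕ → ℝ)

/-- The requests that lie ahead once the time `t` has passed. -/
noncomputable def advance (t : ℝ) (q : Requests) : Requests :=
  (residual t q.1, shift (crossIdx q.1 t) q.2)

/-- The index of the first forwarded request, `0` if there is none. -/
noncomputable def forwardIdx (d : ℕ → ℝ) : ℕ := sInf {n | d n = 1}

/-- The time until the first forwarded request. -/
noncomputable def forwardDelay (q : Requests) : ℝ := partialSum q.1 (forwardIdx q.2 + 1)

/-- The requests after the first forwarded one. -/
noncomputable def dropForwarded (q : Requests) : Requests :=
  (shift (forwardIdx q.2 + 1) q.1, shift (forwardIdx q.2 + 1) q.2)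

@[fun_prop] theorem measurable_advance {V : Type*} [MeasurableSpace V] {q : V → Requests}
    {t : V → ℝ} (hq : Measurable q) (ht : Measurable t) :
    Measurable fun v => advance (t v) (q v) :=
  (measurable_residual hq.fst ht).prodMk
    (measurable_shift_index (measurable_crossIdx hq.fst ht) hq.snd)

@[fun_prop] theorem measurable_forwardIdx : Measurable forwardIdx :=
  measurable_sInf_nat fun n => measurableSet_eq_fun (measurable_pi_apply n) measurable_const

@[fun_prop] theorem measurable_forwardDelay : Measurable forwardDelay :=
  measurable_partialSum_index (N := fun q : Requests => forwardIdx q.2 + 1)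
    ((measurable_forwardIdx.comp measurable_snd).add_const 1) measurable_fst

@[fun_prop] theorem measurable_dropForwarded : Measurable dropForwarded := by
  have h : Measurable fun q : Requests => forwardIdx q.2 + 1 :=
    (measurable_forwardIdx.comp measurable_snd).add_const 1
  exact (measurable_shift_index h measurable_fst).prodMk (measurable_shift_index h measurable_snd)

theorem le_forwardIdx_iff {d : ℕ → ℝ} (hd : ∃ n, d n = 1) {k : ℕ} :
    k ≤ forwardIdx d ↔ ∀ i < k, d i ≠ 1 := by
  constructor
  · intro h i hi h1
    exact absurd (Nat.sInf_le (s := {n | d n = 1}) h1) (by rw [← forwardIdx]; omega)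
  · intro h
    by_contra hlt
    exact h _ (not_le.1 hlt) (Nat.sInf_mem (s := {n | d n = 1}) hd)

theorem forwardIdx_eq_iff {d : ℕ → ℝ} (hd : ∃ n, d n = 1) {n : ℕ} :
    forwardIdx d = n ↔ (∀ i < n, d i ≠ 1) ∧ d n = 1 := by
  constructor
  · rintro rfl
    exact ⟨(le_forwardIdx_iff hd).1 le_rfl, Nat.sInf_mem (s := {n | d n = 1}) hd⟩
  · rintro ⟨h1, h2⟩
    exact le_antisymm (Nat.sInf_le (s := {n | d n = 1}) h2) ((le_forwardIdx_iff hd).2 h1)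

section RequestLaw

variable {u : ℝ} [IsProbabilityMeasure (expMeasure u)] (κ : Measure ℝ) [IsProbabilityMeasure κ]

variable (u) in
/-- The law of the requests: exponential gaps of rate `u` and independent marks with law `κ`. -/
noncomputable abbrev requestLaw : Measure Requests := (iidLaw (expMeasure u)).prod (iidLaw κ)

theorem measurePreserving_advance (hu : 0 < u) {t : ℝ} (ht : 0 ≤ t) :
    MeasurePreserving (advance t) (requestLaw u κ) (requestLaw u κ) := by
  refine (measurePreserving_residual hu ht).skew_product
    (g := fun b d => shift (crossIdx b t) d) ?_
    (ae_of_all _ fun b => (measurePreserving_shift κ _).map_eq)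
  exact measurable_shift_index (measurable_crossIdx measurable_fst measurable_const) measurable_snd

theorem ae_frequently_forwarded (hκ : κ {1} ≠ 0) :
    ∀ᵐ q ∂requestLaw u κ, ∃ᶠ n in atTop, q.2 n = 1 :=
  measurePreserving_snd.quasiMeasurePreserving.ae
    (ae_frequently_mem κ (measurableSet_singleton 1) hκ)

/-- The requests after the first forwarded one are fresh and independent of its epoch. -/
theorem measurePreserving_forward (hκ : κ {1} ≠ 0) :
    MeasurePreserving (fun q => (forwardDelay q, dropForwarded q)) (requestLaw u κ)
      (((requestLaw u κ).map forwardDelay).prod (requestLaw u κ)) := by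
  have hm : Measurable fun q => (forwardDelay q, dropForwarded q) := by fun_prop
  refine ⟨hm, (Measure.prod_eq fun B E hB hE => ?_).symm⟩
  have hprob := Measure.isProbabilityMeasure_map
    (μ := requestLaw u κ) measurable_forwardDelay.aemeasurable
  have hN : Measurable fun q : Requests => forwardIdx q.2 := by fun_prop
  rw [Measure.map_apply hm (hB.prod hE), Measure.map_apply measurable_forwardDelay hB,
    measure_eq_tsum_index _ hN ((hB.prod hE).preimage hm),
    measure_eq_tsum_index _ hN (hB.preimage measurable_forwardDelay), ← ENNReal.tsum_mul_right]
  refine tsum_congr fun n => ?_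
  -- Both the gaps and the marks are cut after index `n`; `f` is the event that request `n` is the
  -- first forwarded one, which agrees with `forwardIdx q.2 = n` unless no request is forwarded.
  set f : (ℕ → ℝ) → Prop := fun d => (∀ i < n, d i ≠ 1) ∧ d n = 1
  have hfm : Measurable f := by
    have hA : MeasurableSet {d : ℕ → ℝ | ∀ i < n, d i ≠ 1} := by
      simp only [Set.ofPred_forall]
      exact .iInter fun i => .iInter fun _ =>
        (measurableSet_eq_fun (measurable_pi_apply i) measurable_const).compl
    exact measurableSet_setOfPred.1
      (hA.inter (measurableSet_eq_fun (measurable_pi_apply n) measurable_const))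
  have h1 := measurePreserving_shift_right (expMeasure u) (n := n + 1)
    (f := fun b => partialSum b (n + 1)) (by fun_prop) (fun p x => partialSum_glue _ _ _)
  have h2 := measurePreserving_shift_right κ (n := n + 1) (f := f) hfm (fun p x => by
    have hg : ∀ i ≤ n, glue (n + 1) p x i = p i := fun i hi => glue_of_lt (by omega) p x
    refine propext ⟨fun h => ⟨fun i hi => ?_, ?_⟩, fun h => ⟨fun i hi => ?_, ?_⟩⟩
    · rw [← hg i hi.le]; exact h.1 i hi
    · rw [← hg n le_rfl]; exact h.2
    · rw [hg i hi.le]; exact h.1 i hi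
    · rw [hg n le_rfl]; exact h.2)
  have hp1 := Measure.isProbabilityMeasure_map
    (μ := iidLaw (expMeasure u)) (f := fun b => partialSum b (n + 1)) (by fun_prop)
  have hp2 := Measure.isProbabilityMeasure_map (μ := iidLaw κ) hfm.aemeasurable
  have h3 := (measurePreserving_prod_comm _ _ _ _).comp (h1.prod h2)
  have hsec : ∀ F : Set Requests, MeasurableSet F →
      requestLaw u κ ((fun q => (forwardDelay q, dropForwarded q)) ⁻¹' (B ×ˢ F) ∩
        {q | forwardIdx q.2 = n}) =
      (((iidLaw (expMeasure u)).map fun b => partialSum b (n + 1)).prod ((iidLaw κ).map f))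
        (B ×ˢ {True}) * requestLaw u κ F := by
    intro F hF
    rw [← Measure.prod_prod, ← h3.measure_preimage
      ((hB.prod (measurableSet_singleton _)).prod hF).nullMeasurableSet]
    refine measure_congr ?_
    filter_upwards [ae_frequently_forwarded (u := u) κ hκ] with q hq
    have hiff := forwardIdx_eq_iff (n := n) hq.exists
    refine propext ?_
    constructor
    · rintro ⟨⟨hb, hf⟩, rfl⟩
      exact ⟨⟨hb, eq_true (hiff.1 rfl)⟩, hf⟩
    · rintro ⟨⟨hb, hf⟩, hF'⟩
      have hidx := hiff.2 (of_eq_true hf)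
      refine ⟨⟨?_, ?_⟩, hidx⟩
      · change partialSum q.1 (forwardIdx q.2 + 1) ∈ B
        rw [hidx]; exact hb
      · change (shift (forwardIdx q.2 + 1) q.1, shift (forwardIdx q.2 + 1) q.2) ∈ F
        rw [hidx]; exact hF'
  have huniv := hsec Set.univ .univ
  rw [measure_univ, mul_one] at huniv
  rw [hsec E hE, ← huniv]
  congr 3
  ext q
  simp

/-- The first forwarded request has the index `k` or a later one with probability `(1 - p) ^ k`,
independently of the gaps, which makes the mean delay a geometric series. -/
theorem lintegral_forwardDelay (hu : 0 < u) {c : ℝ} (hc : 0 < c)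
    (hκ : κ {1} = ENNReal.ofReal (c / u)) :
    ∫⁻ q, ENNReal.ofReal (forwardDelay q) ∂requestLaw u κ = ENNReal.ofReal (1 / c) := by
  have hp0 : ENNReal.ofReal (c / u) ≠ 0 := by
    simpa using div_pos hc hu
  have hmeas : ∀ k : ℕ, MeasurableSet (Set.pi (Finset.range k : Set ℕ) fun _ => ({1}ᶜ : Set ℝ)) :=
    fun k => .pi (Set.to_countable _) fun _ _ => (measurableSet_singleton 1).compl
  have hgood : ∀ᵐ q ∂requestLaw u κ, GoodGaps q.1 :=
    measurePreserving_fst.quasiMeasurePreserving.ae (ae_goodGaps hu)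
  have hae : ∀ᵐ q ∂requestLaw u κ, ENNReal.ofReal (forwardDelay q) =
      ∑' k, ENNReal.ofReal (q.1 k) *
        (Set.pi (Finset.range k : Set ℕ) fun _ => ({1}ᶜ : Set ℝ)).indicator 1 q.2 := by
    filter_upwards [hgood, ae_frequently_forwarded (u := u) κ (hκ ▸ hp0)] with q hq hfreq
    have hk : ∀ k, q.2 ∈ (Set.pi (Finset.range k : Set ℕ) fun _ => ({1}ᶜ : Set ℝ)) ↔
        k ≤ forwardIdx q.2 := by
      intro k
      rw [le_forwardIdx_iff hfreq.exists]
      simp [Set.mem_pi]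
    rw [forwardDelay, partialSum, ENNReal.ofReal_sum_of_nonneg fun i _ => (hq.pos i).le,
      tsum_eq_sum (s := Finset.range (forwardIdx q.2 + 1))]
    · refine Finset.sum_congr rfl fun k hk' => ?_
      rw [Set.indicator_of_mem ((hk k).2 (Nat.lt_succ_iff.1 (Finset.mem_range.1 hk'))),
        Pi.one_apply, mul_one]
    · intro k hk'
      rw [Set.indicator_of_notMem, mul_zero]
      rw [hk k]
      simpa using hk'
  have hterm : ∀ k : ℕ, ∫⁻ q, ENNReal.ofReal (q.1 k) *
      (Set.pi (Finset.range k : Set ℕ) fun _ => ({1}ᶜ : Set ℝ)).indicator 1 q.2 ∂requestLaw u κ =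
      ENNReal.ofReal (1 / u) * (1 - ENNReal.ofReal (c / u)) ^ k := by
    intro k
    rw [lintegral_prod_mul (f := fun b : ℕ → ℝ => ENNReal.ofReal (b k))
      (ENNReal.measurable_ofReal.comp (measurable_pi_apply k)).aemeasurable
      ((measurable_one.indicator (hmeas k)).aemeasurable), lintegral_indicator_one (hmeas k),
      Measure.infinitePi_pi _ fun _ _ => (measurableSet_singleton 1).compl,
      prob_compl_eq_one_sub (measurableSet_singleton 1), hκ, Finset.prod_const, Finset.card_range,
      ← lintegral_expMeasure hu]
    congr 1
    exact (measurePreserving_eval_infinitePi (fun _ => expMeasure u) k).lintegral_comp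
      ENNReal.measurable_ofReal
  rw [lintegral_congr_ae hae, lintegral_tsum, tsum_congr hterm, ENNReal.tsum_mul_left,
    ENNReal.tsum_geometric, ENNReal.sub_sub_cancel ENNReal.one_ne_top (hκ ▸ prob_le_one),
    ← ENNReal.ofReal_inv_of_pos (by positivity), ← ENNReal.ofReal_mul (by positivity)]
  · congr 1; field_simp
  · intro k
    exact ((ENNReal.measurable_ofReal.comp ((measurable_pi_apply k).comp measurable_fst)).mul
      ((measurable_one.indicator (hmeas k)).comp measurable_snd)).aemeasurable

end RequestLaw

/-! ### The transmission attempts -/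

/-- The index of the first attempt that is completed before the next update, when `row` holds the
transmission times of the attempts and `x` the gaps between the updates; `0` if there is none. -/
noncomputable def attemptIdx (row x : ℕ → ℝ) : ℕ := sInf {m | row m < x m}

/-- The time from the start of the first attempt to the completion of the successful one. -/
noncomputable def transmissionDelay (row x : ℕ → ℝ) : ℝ :=
  partialSum x (attemptIdx row x) + row (attemptIdx row x)

theorem measurable_attemptIdx :
    Measurable fun v : (ℕ → ℝ) × (ℕ → ℝ) => attemptIdx v.1 v.2 :=
  measurable_sInf_nat fun n => measurableSet_lt (by fun_prop) (by fun_prop)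

@[fun_prop] theorem measurable_transmissionDelay {V : Type*} [MeasurableSpace V]
    {row x : V → ℕ → ℝ} (hrow : Measurable row) (hx : Measurable x) :
    Measurable fun v => transmissionDelay (row v) (x v) := by
  have h := measurable_attemptIdx.comp (hrow.prodMk hx)
  exact (measurable_partialSum_index h hx).add (measurable_apply_index h hrow)

theorem attemptIdx_eq_iff {row x : ℕ → ℝ} (h : ∃ m, row m < x m) {n : ℕ} :
    attemptIdx row x = n ↔ (∀ i < n, x i ≤ row i) ∧ row n < x n := by
  constructor
  · rintro rfl
    exact ⟨fun i hi => not_lt.1 (Nat.notMem_of_lt_sInf hi), Nat.sInf_mem (s := {m | row m < x m}) h⟩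
  · rintro ⟨h1, h2⟩
    refine le_antisymm (Nat.sInf_le (s := {m | row m < x m}) h2) ?_
    by_contra hlt
    exact absurd (h1 _ (not_le.1 hlt)) (not_le.2 (Nat.sInf_mem (s := {m | row m < x m}) h))

section AttemptLaw

variable {s lam : ℝ} [IsProbabilityMeasure (expMeasure s)] [IsProbabilityMeasure (expMeasure lam)]

variable (s lam) in
/-- The law of the transmission times of a cycle together with the gaps between the updates. -/
noncomputable abbrev attemptLaw : Measure ((ℕ → ℝ) × (ℕ → ℝ)) :=
  (iidLaw (expMeasure s)).prod (iidLaw (expMeasure lam))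

variable (s lam) in
theorem measurePreserving_attempt_head_tail :
    MeasurePreserving
      (fun v : (ℕ → ℝ) × (ℕ → ℝ) => ((v.1 0, v.2 0), (shift 1 v.1, shift 1 v.2)))
      (attemptLaw s lam) (((expMeasure s).prod (expMeasure lam)).prod (attemptLaw s lam)) :=
  (measurePreserving_prod_comm _ _ _ _).comp
    ((measurePreserving_head_tail (expMeasure s)).prod
      (measurePreserving_head_tail (expMeasure lam)))

/-- The probability that an attempt is interrupted. -/
theorem measure_interrupted (hs : 0 < s) (hlam : 0 < lam) :
    ((expMeasure s).prod (expMeasure lam)) {a | a.2 ≤ a.1} = ENNReal.ofReal (lam / (lam + s)) := by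
  have hcompl : ((expMeasure s).prod (expMeasure lam)) {a | a.1 < a.2} =
      ENNReal.ofReal (s / (lam + s)) := by
    rw [Measure.prod_apply (measurableSet_lt measurable_fst measurable_snd),
      ← lintegral_exp_neg_expMeasure hs hlam]
    refine lintegral_congr_ae ?_
    filter_upwards [expMeasure_ae_pos s] with t ht
    exact expMeasure_Ioi hlam ht.le
  have h : {a : ℝ × ℝ | a.2 ≤ a.1} = {a | a.1 < a.2}ᶜ := by ext; simp
  rw [h, prob_compl_eq_one_sub (measurableSet_lt measurable_fst measurable_snd), hcompl,
    ← ENNReal.ofReal_one, ← ENNReal.ofReal_sub _ (by positivity)]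
  congr 1
  field_simp
  ring

/-- Almost surely some attempt succeeds: the probability `p` that none does satisfies
`p = q * p`, where `q < 1` is the probability that the first attempt is interrupted. -/
theorem ae_exists_attempt (hs : 0 < s) (hlam : 0 < lam) :
    ∀ᵐ v ∂attemptLaw s lam, ∃ m, v.1 m < v.2 m := by
  have hm : MeasurableSet {v : (ℕ → ℝ) × (ℕ → ℝ) | ∀ m, v.2 m ≤ v.1 m} := by
    simp only [Set.ofPred_forall]
    exact .iInter fun m => measurableSet_le (by fun_prop) (by fun_prop)
  have hrec : attemptLaw s lam {v | ∀ m, v.2 m ≤ v.1 m} =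
      ENNReal.ofReal (lam / (lam + s)) * attemptLaw s lam {v | ∀ m, v.2 m ≤ v.1 m} := by
    rw [← measure_interrupted hs hlam, ← Measure.prod_prod,
      ← (measurePreserving_attempt_head_tail s lam).measure_preimage
        ((measurableSet_le measurable_snd measurable_fst).prod hm).nullMeasurableSet]
    congr 1
    ext v
    constructor
    · intro h
      exact ⟨h 0, fun m => h (1 + m)⟩
    · rintro ⟨h0, h1⟩ (_ | m)
      · exact h0
      · simpa [add_comm 1 m] using h1 m
  rw [ae_iff]
  simp only [not_exists, not_lt]
  by_contra h0
  have hlt : ENNReal.ofReal (lam / (lam + s)) < 1 := by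
    rw [ENNReal.ofReal_lt_one, div_lt_one (by positivity)]
    linarith
  have := ENNReal.mul_lt_mul_left h0 (measure_ne_top (attemptLaw s lam) _) hlt
  rw [one_mul, ← hrec] at this
  exact lt_irrefl _ this

theorem ae_attempt_pos :
    ∀ᵐ v ∂attemptLaw s lam, ∀ m, 0 < v.1 m :=
  measurePreserving_fst.quasiMeasurePreserving.ae
    (ae_all_iff.2 fun m => (measurePreserving_eval_infinitePi (fun _ => expMeasure s)
      m).quasiMeasurePreserving.ae (expMeasure_ae_pos s))

theorem ae_attempt_goodGaps (hlam : 0 < lam) : ∀ᵐ v ∂attemptLaw s lam, GoodGaps v.2 :=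
  measurePreserving_snd.quasiMeasurePreserving.ae (ae_goodGaps hlam)

/-- The updates after the delivery are fresh and independent of the duration of the transmission. -/
theorem measurePreserving_transmission (hs : 0 < s) (hlam : 0 < lam) :
    MeasurePreserving
      (fun v => (transmissionDelay v.1 v.2, residual (transmissionDelay v.1 v.2) v.2))
      (attemptLaw s lam)
      (((attemptLaw s lam).map fun v => transmissionDelay v.1 v.2).prod
        (iidLaw (expMeasure lam))) := by
  refine measurePreserving_stopped (r := lam) (iidLaw (expMeasure s))
    (N := fun v => attemptIdx v.1 v.2)
    (H := fun n => {v | (∀ i < n, v.2 i ≤ v.1 i) ∧ 0 ≤ v.1 n}) (τ := fun n v => v.1 n)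
    (κ := fun n v => partialSum v.2 n + v.1 n) (e := fun v => transmissionDelay v.1 v.2)
    (R := fun v => residual (transmissionDelay v.1 v.2) v.2)
    measurable_attemptIdx (fun n => ?_) (fun n => by fun_prop) (fun n => by fun_prop)
    (by fun_prop) (by fun_prop) (fun n w p x => ?_) (fun n w p x => rfl)
    (fun n w p x => by simp [partialSum_glue]) (fun n v hv => hv.2) ?_
  · have hA : MeasurableSet {v : (ℕ → ℝ) × (ℕ → ℝ) | ∀ i < n, v.2 i ≤ v.1 i} := by
      simp only [Set.ofPred_forall]
      exact .iInter fun i => .iInter fun _ => measurableSet_le (by fun_prop) (by fun_prop)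
    have hB : MeasurableSet {v : (ℕ → ℝ) × (ℕ → ℝ) | 0 ≤ v.1 n} :=
      measurableSet_le measurable_const (by fun_prop)
    exact hA.inter hB
  · refine and_congr_left fun _ => forall₂_congr fun i hi => ?_
    simp [glue_of_lt hi]
  · -- The delivery falls into the gap of the successful attempt.
    filter_upwards [ae_exists_attempt hs hlam, ae_attempt_pos, ae_attempt_goodGaps hlam]
      with v hex hrow hx n
    have hiff := attemptIdx_eq_iff hex (n := n)
    refine ⟨?_, fun hn => ?_⟩
    · rw [hiff]
      exact ⟨fun h => ⟨⟨h.1, (hrow n).le⟩, h.2⟩, fun h => ⟨h.1.1, h.2⟩⟩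
    · have he : transmissionDelay v.1 v.2 = partialSum v.2 n + v.1 n := by
        rw [transmissionDelay, hn]
      refine ⟨he, ?_⟩
      have hlt := (hiff.1 hn).2
      have hcross : crossIdx v.2 (transmissionDelay v.1 v.2) = n := by
        refine crossIdx_eq hx.pos ?_ ?_
        · rw [he]; linarith [hrow n]
        · rw [he, partialSum_succ]; linarith
      rw [residual, hcross, he, partialSum_succ]
      congr 1; ring

/-- The part of the transmission that is spent in attempt `k` is the minimum of the transmission
time and the next gap if all earlier attempts are interrupted, and nothing otherwise. The means of
these parts form a geometric series. -/
theorem lintegral_transmissionDelay (hs : 0 < s) (hlam : 0 < lam) :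
    ∫⁻ v, ENNReal.ofReal (transmissionDelay v.1 v.2) ∂attemptLaw s lam =
      ENNReal.ofReal (1 / s) := by
  set q := ENNReal.ofReal (lam / (lam + s)) with hq
  set g : ℕ → (ℕ → ℝ) × (ℕ → ℝ) → ℝ≥0∞ := fun k =>
    {v : (ℕ → ℝ) × (ℕ → ℝ) | ∀ i < k, v.2 i ≤ v.1 i}.indicator
      fun v => ENNReal.ofReal (min (v.2 k) (v.1 k)) with hg
  have hm : ∀ k, MeasurableSet {v : (ℕ → ℝ) × (ℕ → ℝ) | ∀ i < k, v.2 i ≤ v.1 i} := by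
    intro k
    simp only [Set.ofPred_forall]
    exact .iInter fun i => .iInter fun _ => measurableSet_le (by fun_prop) (by fun_prop)
  have hgm : ∀ k, Measurable (g k) := fun k => Measurable.indicator (by fun_prop) (hm k)
  have hae : ∀ᵐ v ∂attemptLaw s lam,
      ENNReal.ofReal (transmissionDelay v.1 v.2) = ∑' k, g k v := by
    filter_upwards [ae_exists_attempt hs hlam, ae_attempt_pos, ae_attempt_goodGaps hlam]
      with v hex hrow hx
    obtain ⟨h1, h2⟩ := (attemptIdx_eq_iff hex).1 rfl
    rw [tsum_eq_sum (s := Finset.range (attemptIdx v.1 v.2 + 1)), Finset.sum_range_succ,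
      transmissionDelay, partialSum, ENNReal.ofReal_add (Finset.sum_nonneg fun i _ => (hx.pos i).le)
        (hrow _).le, ENNReal.ofReal_sum_of_nonneg fun i _ => (hx.pos i).le]
    · congr 1
      · refine Finset.sum_congr rfl fun k hk => ?_
        have hk := Finset.mem_range.1 hk
        have hmem : v ∈ {v : (ℕ → ℝ) × (ℕ → ℝ) | ∀ i < k, v.2 i ≤ v.1 i} :=
          fun i hi => h1 i (hi.trans hk)
        simp only [hg]
        rw [Set.indicator_of_mem hmem, min_eq_left (h1 k hk)]
      · have hmem : v ∈ {w : (ℕ → ℝ) × (ℕ → ℝ) | ∀ i < attemptIdx v.1 v.2, w.2 i ≤ w.1 i} := h1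
        simp only [hg]
        rw [Set.indicator_of_mem hmem, min_eq_right h2.le]
    · intro k hk
      refine Set.indicator_of_notMem (fun h => ?_) _
      have : attemptIdx v.1 v.2 < k := by simpa using hk
      exact absurd (h _ this) (not_le.2 h2)
  have hstep : ∀ k, ∫⁻ v, g (k + 1) v ∂attemptLaw s lam = q * ∫⁻ v, g k v ∂attemptLaw s lam := by
    intro k
    have hpt : ∀ v : (ℕ → ℝ) × (ℕ → ℝ), g (k + 1) v =
        {a : ℝ × ℝ | a.2 ≤ a.1}.indicator 1 (v.1 0, v.2 0) * g k (shift 1 v.1, shift 1 v.2) := by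
      intro v
      have hiff : (∀ i < k + 1, v.2 i ≤ v.1 i) ↔
          v.2 0 ≤ v.1 0 ∧ ∀ i < k, v.2 (1 + i) ≤ v.1 (1 + i) := by
        constructor
        · exact fun h => ⟨h 0 (by omega), fun i hi => h (1 + i) (by omega)⟩
        · rintro ⟨h0, h1⟩ (_ | i) hi
          · exact h0
          · simpa [add_comm 1 i] using h1 i (by omega)
      simp only [hg, Set.indicator_apply, Set.mem_ofPred_eq, hiff, shift_apply, Pi.one_apply,
        add_comm 1 k]
      by_cases h0 : v.2 0 ≤ v.1 0 <;> simp [h0]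
    have hms : MeasurableSet {a : ℝ × ℝ | a.2 ≤ a.1} :=
      measurableSet_le measurable_snd measurable_fst
    rw [lintegral_congr hpt, (measurePreserving_attempt_head_tail s lam).lintegral_comp
      (f := fun z => {a : ℝ × ℝ | a.2 ≤ a.1}.indicator 1 z.1 * g k z.2)
      (((measurable_one.indicator hms).comp measurable_fst).mul ((hgm k).comp measurable_snd)),
      lintegral_prod_mul (measurable_one.indicator hms).aemeasurable (hgm k).aemeasurable,
      lintegral_indicator_one hms, measure_interrupted hs hlam]
  have hzero : ∫⁻ v, g 0 v ∂attemptLaw s lam = ENNReal.ofReal (1 / lam) * q := by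
    have h0 : ∀ v, g 0 v = ENNReal.ofReal (min (v.2 0) (v.1 0)) := by
      intro v; simp [hg]
    -- Given the transmission time `t`, both the mean of the minimum and the probability of an
    -- interruption are multiples of `1 - exp (-(lam * t))`.
    have hq' : q = ∫⁻ t, ENNReal.ofReal (1 - Real.exp (-(lam * t))) ∂expMeasure s := by
      rw [hq, ← measure_interrupted hs hlam,
        Measure.prod_apply (measurableSet_le measurable_snd measurable_fst)]
      refine lintegral_congr_ae ?_
      filter_upwards [expMeasure_ae_pos s] with t ht
      have : Prod.mk t ⁻¹' {a : ℝ × ℝ | a.2 ≤ a.1} = (Set.Ioi t)ᶜ := by ext; simp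
      rw [this, prob_compl_eq_one_sub measurableSet_Ioi, expMeasure_Ioi hlam ht.le,
        ENNReal.ofReal_sub _ (Real.exp_pos _).le, ENNReal.ofReal_one]
    rw [lintegral_congr h0]
    refine ((measurePreserving_eval_infinitePi (fun _ => expMeasure s) 0).prod
      (measurePreserving_eval_infinitePi (fun _ => expMeasure lam) 0)).lintegral_comp
      (f := fun a : ℝ × ℝ => ENNReal.ofReal (min a.2 a.1)) (by fun_prop) |>.trans ?_
    rw [lintegral_prod _ (by fun_prop), hq', ← lintegral_const_mul _ (by fun_prop)]
    refine lintegral_congr_ae ?_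
    filter_upwards [expMeasure_ae_pos s] with t ht
    exact lintegral_min_expMeasure hlam ht.le
  have hterm : ∀ k, ∫⁻ v, g k v ∂attemptLaw s lam = ENNReal.ofReal (1 / lam) * q * q ^ k := by
    intro k
    induction k with
    | zero => rw [hzero, pow_zero, mul_one]
    | succ k ih => rw [hstep, ih]; ring
  have hle : lam / (lam + s) ≤ 1 := by
    rw [div_le_one (by positivity)]; linarith
  have h1q : 1 - q = ENNReal.ofReal (s / (lam + s)) := by
    rw [hq, ← ENNReal.ofReal_one, ← ENNReal.ofReal_sub _ (by positivity)]
    congr 1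
    field_simp
    ring
  rw [lintegral_congr_ae hae, lintegral_tsum fun k => (hgm k).aemeasurable, tsum_congr hterm,
    ENNReal.tsum_mul_left, ENNReal.tsum_geometric, h1q,
    ← ENNReal.ofReal_inv_of_pos (by positivity), hq, ← ENNReal.ofReal_mul (by positivity),
    ← ENNReal.ofReal_mul (by positivity)]
  congr 1
  field_simp

end AttemptLaw

/-! ### One update cycle as a transformation of the future -/

/-- The randomness that lies ahead at the beginning of a cycle: the requests, the gaps between the
updates at the source, and the transmission times of this cycle and of the later ones. -/
abbrev Future := Requests × ((ℕ → ℝ) × (ℕ → ℕ → ℝ))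

namespace Future

/-- The time during which the copy is fresh. -/
def freshPhase (z : Future) : ℝ := z.2.1 0

/-- The requests that lie ahead when the copy becomes outdated. -/
noncomputable def outdatedRequests (z : Future) : Requests := advance z.freshPhase z.1

/-- The time from the moment when the copy becomes outdated to the request that starts the
transmission. -/
noncomputable def waitPhase (z : Future) : ℝ := forwardDelay z.outdatedRequests

/-- The gaps between the updates that lie ahead when the transmission starts. -/
noncomputable def sendUpdates (z : Future) : ℕ → ℝ := residual z.waitPhase (shift 1 z.2.1)

/-- The time that the transmission takes, interrupted attempts included. -/
noncomputable def sendPhase (z : Future) : ℝ := transmissionDelay (z.2.2 0) z.sendUpdates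

/-- The future at the end of the cycle. -/
noncomputable def next (z : Future) : Future :=
  (advance z.sendPhase (dropForwarded z.outdatedRequests),
    (residual z.sendPhase z.sendUpdates, shift 1 z.2.2))

/-- The durations of the three phases of the cycle. -/
noncomputable def phases (z : Future) : (ℝ × ℝ) × ℝ := ((z.freshPhase, z.waitPhase), z.sendPhase)

/-- The duration of the whole cycle. -/
noncomputable def cycle (z : Future) : ℝ := z.freshPhase + z.waitPhase + z.sendPhase

end Future

section Chain

variable {α β γ τ ρ : Type*} [MeasurableSpace α] [MeasurableSpace β] [MeasurableSpace γ]
  [MeasurableSpace τ] [MeasurableSpace ρ] {μa : Measure α} {μb : Measure β} {μt : Measure τ}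
  {μr : Measure ρ} {μc : Measure γ} [SFinite μa] [SFinite μb] [SFinite μt] [SFinite μc]

/-- If `e` splits a fresh variable of `α` into an independent pair, then the first component can be
added to the record `τ` of the past while the second one stays fresh. -/
theorem measurePreserving_record [SFinite μr] {e : α → ρ × β}
    (he : MeasurePreserving e μa (μr.prod μb)) :
    MeasurePreserving (fun p : τ × α => ((p.1, (e p.2).1), (e p.2).2))
      (μt.prod μa) ((μt.prod μr).prod μb) :=
  (measurePreserving_assoc_symm μt μr μb).comp ((MeasurePreserving.id μt).prod he)

theorem measurePreserving_record_left {e : α → ρ × β} (he : MeasurePreserving e μa (μr.prod μb)) :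
    MeasurePreserving (fun p : α × γ => ((e p.1).1, ((e p.1).2, p.2)))
      (μa.prod μc) (μr.prod (μb.prod μc)) :=
  (measurePreserving_prodAssoc μr μb μc).comp (he.prod (.id μc))

theorem measurePreserving_record_right [SFinite μr] {e : α → ρ × β}
    (he : MeasurePreserving e μa (μr.prod μb)) :
    MeasurePreserving (fun p : γ × α => ((e p.2).1, (p.1, (e p.2).2)))
      (μc.prod μa) (μr.prod (μc.prod μb)) :=
  (measurePreserving_left_comm μc μr μb).comp ((MeasurePreserving.id μc).prod he)

/-- A fresh variable stays fresh when it is transformed in a law-preserving way that is chosen by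
the past. -/
theorem measurePreserving_act {g : τ → α → α} (hg : Measurable (Function.uncurry g))
    (h : ∀ᵐ t ∂μt, MeasurePreserving (g t) μa μa) :
    MeasurePreserving (fun p : τ × α => (p.1, g p.1 p.2)) (μt.prod μa) (μt.prod μa) :=
  (MeasurePreserving.id μt).skew_product hg (h.mono fun _ ht => ht.map_eq)

end Chain

section Law

variable {lam u s : ℝ} [IsProbabilityMeasure (expMeasure lam)]
  [IsProbabilityMeasure (expMeasure u)] [IsProbabilityMeasure (expMeasure s)]
  (κ : Measure ℝ) [IsProbabilityMeasure κ]

variable (lam u s) in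
/-- The law of the future. -/
noncomputable abbrev futureLaw : Measure Future :=
  (requestLaw u κ).prod
    ((iidLaw (expMeasure lam)).prod (iidLaw (iidLaw (expMeasure s))))

variable (lam u s) in
/-- The law of the phases of a cycle: the waiting time does not depend on the fresh phase, nor the
transmission on the two phases before it. -/
noncomputable abbrev phaseLaw : Measure ((ℝ × ℝ) × ℝ) :=
  ((expMeasure lam).prod ((requestLaw u κ).map forwardDelay)).prod
    ((attemptLaw s lam).map fun v => transmissionDelay v.1 v.2)

instance : IsProbabilityMeasure ((requestLaw u κ).map forwardDelay) :=
  Measure.isProbabilityMeasure_map measurable_forwardDelay.aemeasurable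

instance : IsProbabilityMeasure ((attemptLaw s lam).map fun v => transmissionDelay v.1 v.2) :=
  Measure.isProbabilityMeasure_map
    (measurable_transmissionDelay measurable_fst measurable_snd).aemeasurable

theorem ae_forwardDelay_nonneg (hu : 0 < u) :
    ∀ᵐ t ∂(requestLaw u κ).map forwardDelay, 0 ≤ t := by
  rw [ae_map_iff measurable_forwardDelay.aemeasurable measurableSet_Ici]
  filter_upwards [measurePreserving_fst.quasiMeasurePreserving.ae (ae_goodGaps hu)] with q hq
  exact hq.partialSum_nonneg _

theorem ae_transmissionDelay_nonneg (hlam : 0 < lam) :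
    ∀ᵐ t ∂(attemptLaw s lam).map fun v => transmissionDelay v.1 v.2, 0 ≤ t := by
  rw [ae_map_iff (measurable_transmissionDelay measurable_fst measurable_snd).aemeasurable
    measurableSet_Ici]
  filter_upwards [ae_attempt_pos, ae_attempt_goodGaps hlam] with v hrow hx
  exact add_nonneg (hx.partialSum_nonneg _) (hrow _).le

/-- The future at the end of a cycle is fresh and independent of the phases of the cycle. -/
theorem measurePreserving_cycle (hlam : 0 < lam) (hu : 0 < u) (hs : 0 < s) (hκ : κ {1} ≠ 0) :
    MeasurePreserving (fun z : Future => (z.phases, z.next)) (futureLaw lam u s κ)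
      ((phaseLaw lam u s κ).prod (futureLaw lam u s κ)) := by
  -- The cycle is composed of steps, each of which transforms some component of the future and adds
  -- the duration of a phase to the record. First, the gap until the first update is recorded.
  set Pσ := iidLaw (iidLaw (expMeasure s))
  set Pα := iidLaw (expMeasure lam)
  have outdated := measurePreserving_record_right (μc := requestLaw u κ)
    (measurePreserving_record_left (μc := Pσ) (measurePreserving_head_tail (expMeasure lam)))
  -- The requests go on during the fresh phase.
  have requests₁ := measurePreserving_act (μt := expMeasure lam) (μa := futureLaw lam u s κ)
    (g := fun t z => (advance t z.1, z.2)) (by unfold Function.uncurry; fun_prop)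
    ((expMeasure_ae_pos lam).mono fun t ht =>
      (measurePreserving_advance κ hu ht.le).prod (.id _))
  -- The first forwarded request ends the waiting phase.
  have forward := measurePreserving_record (μt := expMeasure lam)
    (measurePreserving_record_left (μc := Pα.prod Pσ)
      (measurePreserving_forward (u := u) κ hκ))
  -- The updates go on during the waiting phase.
  have updates := measurePreserving_act
    (μt := (expMeasure lam).prod ((requestLaw u κ).map forwardDelay))
    (μa := futureLaw lam u s κ)
    (g := fun t z => (z.1, (residual t.2 z.2.1, z.2.2))) (by unfold Function.uncurry; fun_prop)
    ((Measure.quasiMeasurePreserving_snd.ae (ae_forwardDelay_nonneg κ hu)).mono fun t ht =>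
      (MeasurePreserving.id _).prod ((measurePreserving_residual hlam ht).prod (.id _)))
  -- The transmission uses up the first row of transmission times and leaves fresh updates.
  have attempt : MeasurePreserving
      (fun v : (ℕ → ℝ) × (ℕ → ℕ → ℝ) => (transmissionDelay (v.2 0) v.1,
        (residual (transmissionDelay (v.2 0) v.1) v.1, shift 1 v.2)))
      (Pα.prod Pσ) (((attemptLaw s lam).map fun v => transmissionDelay v.1 v.2).prod
        (Pα.prod Pσ)) :=
    (measurePreserving_record_left (μc := Pσ) (measurePreserving_transmission hs hlam)).comp
      ((measurePreserving_assoc_symm _ _ _).comp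
        ((measurePreserving_left_comm _ _ _).comp
          ((MeasurePreserving.id Pα).prod
            (measurePreserving_head_tail (iidLaw (expMeasure s))))))
  have send := measurePreserving_record
    (μt := (expMeasure lam).prod ((requestLaw u κ).map forwardDelay))
    (measurePreserving_record_right (μc := requestLaw u κ) attempt)
  -- The requests go on during the transmission.
  have requests₂ := measurePreserving_act (μt := phaseLaw lam u s κ) (μa := futureLaw lam u s κ)
    (g := fun t z => (advance t.2 z.1, z.2)) (by unfold Function.uncurry; fun_prop)
    ((Measure.quasiMeasurePreserving_snd.ae (ae_transmissionDelay_nonneg hlam)).mono fun t ht =>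
      (measurePreserving_advance κ hu ht).prod (.id _))
  exact requests₂.comp (send.comp (updates.comp (forward.comp (requests₁.comp outdated))))

theorem measurePreserving_next (hlam : 0 < lam) (hu : 0 < u) (hs : 0 < s) (hκ : κ {1} ≠ 0) :
    MeasurePreserving Future.next (futureLaw lam u s κ) (futureLaw lam u s κ) :=
  measurePreserving_snd.comp (measurePreserving_cycle κ hlam hu hs hκ)

theorem measurePreserving_phases (hlam : 0 < lam) (hu : 0 < u) (hs : 0 < s) (hκ : κ {1} ≠ 0) :
    MeasurePreserving Future.phases (futureLaw lam u s κ) (phaseLaw lam u s κ) :=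
  measurePreserving_fst.comp (measurePreserving_cycle κ hlam hu hs hκ)

/-- Any function of the phases, evaluated in successive cycles, is a sequence of pairwise
independent and identically distributed variables. -/
theorem indepFun_phases (hlam : 0 < lam) (hu : 0 < u) (hs : 0 < s) (hκ : κ {1} ≠ 0)
    {f : (ℝ × ℝ) × ℝ → ℝ} (hf : Measurable f) {i j : ℕ} (hij : i < j) :
    IndepFun (fun z => f (Future.next^[i] z).phases) (fun z => f (Future.next^[j] z).phases)
      (futureLaw lam u s κ) := by
  have hnext := measurePreserving_next κ hlam hu hs hκ
  have hph := measurePreserving_phases κ hlam hu hs hκ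
  have hm : ∀ k, MeasurePreserving (fun z : Future => f (Future.next^[k] z).phases)
      (futureLaw lam u s κ) ((phaseLaw lam u s κ).map f) := fun k =>
    (MeasurePreserving.mk hf rfl).comp (hph.comp (hnext.iterate k))
  rw [indepFun_iff_map_prod_eq_prod_map_map (hm i).measurable.aemeasurable
    (hm j).measurable.aemeasurable, (hm i).map_eq, (hm j).map_eq]
  -- The phases of cycle `j` are those of cycle `k` after the end of cycle `i`.
  obtain ⟨k, rfl⟩ : ∃ k, j = k + 1 + i := ⟨j - i - 1, by omega⟩
  have h := ((MeasurePreserving.mk hf rfl).prod (hm k)).comp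
    ((measurePreserving_cycle κ hlam hu hs hκ).comp (hnext.iterate i))
  rw [← h.map_eq]
  congr 1
  ext z
  · rfl
  · simp only [Function.comp_apply, Prod.map_apply, Function.iterate_add_apply,
      Function.iterate_one]

theorem identDistrib_phases (hlam : 0 < lam) (hu : 0 < u) (hs : 0 < s) (hκ : κ {1} ≠ 0)
    {f : (ℝ × ℝ) × ℝ → ℝ} (hf : Measurable f) (i : ℕ) :
    IdentDistrib (fun z => f (Future.next^[i] z).phases) (fun z => f z.phases)
      (futureLaw lam u s κ) (futureLaw lam u s κ) := by
  have hph := measurePreserving_phases κ hlam hu hs hκ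
  have hi := hph.comp ((measurePreserving_next κ hlam hu hs hκ).iterate i)
  exact IdentDistrib.comp (f := fun z => (Future.next^[i] z).phases) (g := Future.phases)
    ⟨hi.measurable.aemeasurable, hph.measurable.aemeasurable, hi.map_eq.trans hph.map_eq.symm⟩ hf

/-! ### The means of the phases -/

theorem ae_phases_nonneg (hlam : 0 < lam) (hu : 0 < u) :
    ∀ᵐ t ∂phaseLaw lam u s κ, 0 ≤ t.1.1 ∧ 0 ≤ t.1.2 ∧ 0 ≤ t.2 := by
  filter_upwards [Measure.quasiMeasurePreserving_fst.ae (Measure.quasiMeasurePreserving_fst.ae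
      (expMeasure_ae_pos lam)), Measure.quasiMeasurePreserving_fst.ae
      (Measure.quasiMeasurePreserving_snd.ae (ae_forwardDelay_nonneg κ hu)),
      Measure.quasiMeasurePreserving_snd.ae (ae_transmissionDelay_nonneg (s := s) hlam)]
    with t h1 h2 h3 using ⟨h1.le, h2, h3⟩

theorem integrable_and_integral_of_lintegral {V : Type*} [MeasurableSpace V] {m : Measure V}
    {f : V → ℝ} (hf : Measurable f) (h0 : ∀ᵐ v ∂m, 0 ≤ f v) {a : ℝ} (ha : 0 ≤ a)
    (h : ∫⁻ v, ENNReal.ofReal (f v) ∂m = ENNReal.ofReal a) :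
    Integrable f m ∧ ∫ v, f v ∂m = a := by
  refine ⟨⟨hf.aestronglyMeasurable, ?_⟩, ?_⟩
  · rw [hasFiniteIntegral_iff_ofReal h0, h]
    exact ENNReal.ofReal_lt_top
  · rw [integral_eq_lintegral_of_nonneg_ae h0 hf.aestronglyMeasurable, h, ENNReal.toReal_ofReal ha]

theorem mean_freshPhase (hlam : 0 < lam) (hu : 0 < u) :
    Integrable (fun t : (ℝ × ℝ) × ℝ => t.1.1) (phaseLaw lam u s κ) ∧
      ∫ t, t.1.1 ∂phaseLaw lam u s κ = 1 / lam := by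
  refine integrable_and_integral_of_lintegral (by fun_prop)
    ((ae_phases_nonneg κ hlam hu).mono fun t ht => ht.1) (by positivity) ?_
  rw [← lintegral_expMeasure hlam]
  exact (measurePreserving_fst.comp measurePreserving_fst).lintegral_comp
    (f := fun a : ℝ => ENNReal.ofReal a) (by fun_prop)

theorem mean_waitPhase (hlam : 0 < lam) (hu : 0 < u) {c : ℝ} (hc : 0 < c)
    (hκ : κ {1} = ENNReal.ofReal (c / u)) :
    Integrable (fun t : (ℝ × ℝ) × ℝ => t.1.2) (phaseLaw lam u s κ) ∧
      ∫ t, t.1.2 ∂phaseLaw lam u s κ = 1 / c := by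
  refine integrable_and_integral_of_lintegral (by fun_prop)
    ((ae_phases_nonneg κ hlam hu).mono fun t ht => ht.2.1) (by positivity) ?_
  rw [← lintegral_forwardDelay κ hu hc hκ, ← lintegral_map (f := fun a : ℝ => ENNReal.ofReal a)
    (by fun_prop) measurable_forwardDelay]
  exact (measurePreserving_snd.comp measurePreserving_fst).lintegral_comp
    (f := fun a : ℝ => ENNReal.ofReal a) (by fun_prop)

theorem mean_sendPhase (hlam : 0 < lam) (hu : 0 < u) (hs : 0 < s) :
    Integrable (fun t : (ℝ × ℝ) × ℝ => t.2) (phaseLaw lam u s κ) ∧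
      ∫ t, t.2 ∂phaseLaw lam u s κ = 1 / s := by
  refine integrable_and_integral_of_lintegral (by fun_prop)
    ((ae_phases_nonneg κ hlam hu).mono fun t ht => ht.2.2) (by positivity) ?_
  rw [← lintegral_transmissionDelay hs hlam, ← lintegral_map (f := fun a : ℝ => ENNReal.ofReal a)
    (by fun_prop) (measurable_transmissionDelay measurable_fst measurable_snd)]
  exact measurePreserving_snd.lintegral_comp
    (f := fun a : ℝ => ENNReal.ofReal a) (by fun_prop)

theorem mean_cycle (hlam : 0 < lam) (hu : 0 < u) (hs : 0 < s) {c : ℝ} (hc : 0 < c)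
    (hκ : κ {1} = ENNReal.ofReal (c / u)) :
    Integrable (fun t : (ℝ × ℝ) × ℝ => t.1.1 + t.1.2 + t.2) (phaseLaw lam u s κ) ∧
      ∫ t, (t.1.1 + t.1.2 + t.2) ∂phaseLaw lam u s κ = 1 / lam + 1 / c + 1 / s := by
  obtain ⟨h1, e1⟩ := mean_freshPhase (s := s) κ hlam hu
  obtain ⟨h2, e2⟩ := mean_waitPhase (s := s) κ hlam hu hc hκ
  obtain ⟨h3, e3⟩ := mean_sendPhase κ hlam hu hs
  refine ⟨(h1.add h2).add h3, ?_⟩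
  rw [integral_add (f := fun t : (ℝ × ℝ) × ℝ => t.1.1 + t.1.2) (h1.add h2) h3,
    integral_add h1 h2, e1, e2, e3]

end Law

/-! ### The law of the primitive variables -/

theorem measurePreserving_sumElim {ι ι' : Type*} (μ : ι → Measure ℝ) (ν : ι' → Measure ℝ)
    [∀ i, IsProbabilityMeasure (μ i)] [∀ i, IsProbabilityMeasure (ν i)]
    [∀ i, IsProbabilityMeasure (Sum.elim μ ν i)] :
    MeasurePreserving (fun p : (ι → ℝ) × (ι' → ℝ) => Sum.elim p.1 p.2)
      ((Measure.infinitePi μ).prod (Measure.infinitePi ν)) (Measure.infinitePi (Sum.elim μ ν)) := by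
  have hm : Measurable fun p : (ι → ℝ) × (ι' → ℝ) => Sum.elim p.1 p.2 := by
    refine measurable_pi_lambda _ fun i => ?_
    rcases i with i | i <;> simp only [Sum.elim_inl, Sum.elim_inr] <;> fun_prop
  refine ⟨hm, Measure.eq_infinitePi _ fun S t ht => ?_⟩
  have hpre : (fun p : (ι → ℝ) × (ι' → ℝ) => Sum.elim p.1 p.2) ⁻¹' Set.pi S t =
      (Set.pi S.toLeft fun i => t (.inl i)) ×ˢ (Set.pi S.toRight fun i => t (.inr i)) := by
    ext p
    simp [Set.mem_pi, Sum.forall]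
  rw [Measure.map_apply hm (.pi S.countable_toSet fun _ _ => ht _), hpre, Measure.prod_prod,
    Measure.infinitePi_pi _ fun _ _ => ht _, Measure.infinitePi_pi _ fun _ _ => ht _]
  conv_rhs => rw [← Finset.toLeft_disjSum_toRight (u := S)]
  rw [Finset.prod_disjSum]
  simp

/-! ### Events after a given time -/

/-- The points of `E` after time `X` are the events of the gaps `x`, started at time `X`, whose
index satisfies `p`. -/
def Tracks (E : Set ℝ) (X : ℝ) (x : ℕ → ℝ) (p : ℕ → Prop) : Prop :=
  ∀ e, (e ∈ E ∧ X < e) ↔ ∃ k, p k ∧ e = X + partialSum x (k + 1)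

/-- The events of the residual gaps are the events after time `t`, counted from `t` on. -/
theorem partialSum_residual (t : ℝ) (x : ℕ → ℝ) (k : ℕ) :
    partialSum (residual t x) (k + 1) = partialSum x (crossIdx x t + k + 1) - t := by
  induction k with
  | zero => simp [partialSum_succ, residual]
  | succ k ih =>
    rw [partialSum_succ, ih, residual, cons_succ, shift_apply, ← add_assoc,
      partialSum_succ x (crossIdx x t + k + 1)]
    rw [show crossIdx x t + 1 + k = crossIdx x t + k + 1 by ring]
    ring

theorem GoodGaps.shift {x : ℕ → ℝ} (hx : GoodGaps x) (n : ℕ) : GoodGaps (shift n x) := by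
  refine ⟨fun i => hx.pos _, ?_⟩
  have h : ∀ k, partialSum (CacheUpdating.shift n x) k = partialSum x (k + n) - partialSum x n := by
    intro k
    rw [add_comm, partialSum_add]; ring
  simp only [funext h]
  exact tendsto_atTop_add_const_right _ _ ((tendsto_add_atTop_iff_nat n).2 hx.tendsto)

theorem GoodGaps.residual {x : ℕ → ℝ} (hx : GoodGaps x) (t : ℝ) : GoodGaps (residual t x) := by
  refine ⟨?_, ?_⟩
  · rintro (_ | i)
    · exact sub_pos.2 (hx.lt_partialSum_crossIdx t)
    · exact hx.pos _
  · rw [← tendsto_add_atTop_iff_nat 1]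
    simp only [partialSum_residual]
    refine tendsto_atTop_add_const_right _ _ ?_
    have := (tendsto_add_atTop_iff_nat (crossIdx x t + 1)).2 hx.tendsto
    refine this.congr fun k => ?_
    congr 1; ring

theorem Tracks.residual {E : Set ℝ} {X : ℝ} {x : ℕ → ℝ} {p : ℕ → Prop} (h : Tracks E X x p)
    (hx : GoodGaps x) {t : ℝ} (ht : 0 ≤ t) :
    Tracks E (X + t) (residual t x) fun k => p (crossIdx x t + k) := by
  intro e
  have h1 : (e ∈ E ∧ X + t < e) ↔ (e ∈ E ∧ X < e) ∧ X + t < e :=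
    ⟨fun h => ⟨⟨h.1, by linarith [h.2]⟩, h.2⟩, fun h => ⟨h.1.1, h.2⟩⟩
  rw [h1, h e]
  constructor
  · rintro ⟨⟨k, hk, rfl⟩, hlt⟩
    have hle : crossIdx x t ≤ k := Nat.sInf_le (by simpa using! hlt)
    refine ⟨k - crossIdx x t, ?_, ?_⟩
    · simpa only [Nat.add_sub_cancel' hle] using hk
    · rw [partialSum_residual, Nat.add_sub_cancel' hle]; ring
  · rintro ⟨k, hk, rfl⟩
    rw [partialSum_residual]
    refine ⟨⟨_, hk, by ring⟩, ?_⟩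
    have h2 := hx.lt_partialSum_crossIdx t
    have h3 := (partialSum_mono hx.pos).monotone
      (show crossIdx x t + 1 ≤ crossIdx x t + k + 1 by omega)
    linarith

theorem Tracks.shift {E : Set ℝ} {X : ℝ} {x : ℕ → ℝ} {p : ℕ → Prop} (h : Tracks E X x p)
    (hx : GoodGaps x) (n : ℕ) :
    Tracks E (X + partialSum x n) (shift n x) fun k => p (n + k) := by
  intro e
  have h0 : 0 ≤ partialSum x n := hx.partialSum_nonneg n
  have h1 : (e ∈ E ∧ X + partialSum x n < e) ↔ (e ∈ E ∧ X < e) ∧ X + partialSum x n < e :=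
    ⟨fun h => ⟨⟨h.1, by linarith [h.2]⟩, h.2⟩, fun h => ⟨h.1.1, h.2⟩⟩
  rw [h1, h e]
  constructor
  · rintro ⟨⟨k, hk, rfl⟩, hlt⟩
    have hle : n < k + 1 := (partialSum_mono hx.pos).lt_iff_lt.1 (by linarith)
    refine ⟨k - n, ?_, ?_⟩
    · simpa only [Nat.add_sub_cancel' (Nat.lt_succ_iff.1 hle)] using hk
    · rw [add_assoc, ← partialSum_add]
      congr 2; omega
  · rintro ⟨k, hk, rfl⟩
    refine ⟨⟨_, hk, ?_⟩, ?_⟩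
    · rw [add_assoc, ← partialSum_add, add_assoc]
    · have := (partialSum_mono (hx.shift n).pos) (Nat.succ_pos k)
      simpa using this

theorem Tracks.nextAfter {E : Set ℝ} {X : ℝ} {x : ℕ → ℝ} {p : ℕ → Prop} (h : Tracks E X x p)
    (hx : GoodGaps x) {n : ℕ} (hn : p n) (hmin : ∀ i < n, ¬ p i) :
    nextAfter E X = X + partialSum x (n + 1) := by
  refine IsLeast.csInf_eq ⟨(h _).2 ⟨n, hn, rfl⟩, fun e he => ?_⟩
  obtain ⟨k, hk, rfl⟩ := (h e).1 he
  have hle : n ≤ k := not_lt.1 fun hlt => hmin k hlt hk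
  have := (partialSum_mono hx.pos).monotone (Nat.succ_le_succ hle)
  linarith

/-! ### The cycles of a realization -/

namespace Future

/-- The realizations of the future for which the cycle is well defined. -/
structure Good (z : Future) : Prop where
  updates : GoodGaps z.2.1
  requests : GoodGaps z.1.1
  forwarded : ∃ᶠ n in atTop, z.1.2 n = 1
  transmission : ∀ m, 0 < z.2.2 0 m

/-- The realization of the whole process when `z` lies ahead at time `0`. -/
def toPath (z : Future) : Path where
  update := z.2.1
  request := z.1.1
  forwarded n := z.1.2 n = 1
  transmission := z.2.2

/-- From the beginning of cycle `j` at time `X` on, the realization `P` is governed by `z`. -/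
structure Governs (z : Future) (P : Path) (j : ℕ) (X : ℝ) : Prop where
  updates : Tracks P.updateTimes X z.2.1 fun _ => True
  requests : Tracks P.forwardedTimes X z.1.1 fun k => z.1.2 k = 1
  transmission : ∀ i m, P.transmission (j + i) m = z.2.2 i m

theorem Good.governs_toPath {z : Future} (hz : z.Good) : z.Governs z.toPath 0 0 where
  updates e := by
    constructor
    · rintro ⟨⟨n, rfl⟩, -⟩
      exact ⟨n, trivial, by rw [zero_add]; rfl⟩
    · rintro ⟨n, -, rfl⟩
      rw [zero_add]
      exact ⟨⟨n, rfl⟩, (partialSum_mono hz.updates.pos) (Nat.succ_pos n)⟩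
  requests e := by
    constructor
    · rintro ⟨⟨n, hn, rfl⟩, -⟩
      exact ⟨n, hn, by rw [zero_add]; rfl⟩
    · rintro ⟨n, hn, rfl⟩
      rw [zero_add]
      exact ⟨⟨n, hn, rfl⟩, (partialSum_mono hz.requests.pos) (Nat.succ_pos n)⟩
  transmission i m := by rw [zero_add]; rfl

theorem Good.freshPhase_pos {z : Future} (hz : z.Good) : 0 < z.freshPhase := hz.updates.pos 0

theorem Good.outdatedRequests {z : Future} (hz : z.Good) :
    GoodGaps z.outdatedRequests.1 ∧ ∃ n, z.outdatedRequests.2 n = 1 := by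
  refine ⟨hz.requests.residual _, ?_⟩
  obtain ⟨n, hn, h1⟩ := frequently_atTop.1 hz.forwarded (crossIdx z.1.1 z.freshPhase)
  exact ⟨n - crossIdx z.1.1 z.freshPhase, by
    simpa [Future.outdatedRequests, advance, Nat.add_sub_cancel' hn] using h1⟩

theorem Good.waitPhase_nonneg {z : Future} (hz : z.Good) : 0 ≤ z.waitPhase :=
  hz.outdatedRequests.1.partialSum_nonneg _

theorem Good.sendUpdates {z : Future} (hz : z.Good) : GoodGaps z.sendUpdates :=
  (hz.updates.shift 1).residual _

theorem Good.sendPhase_nonneg {z : Future} (hz : z.Good) : 0 ≤ z.sendPhase :=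
  add_nonneg (hz.sendUpdates.partialSum_nonneg _) (hz.transmission _).le

theorem Good.freshPhase_le_cycle {z : Future} (hz : z.Good) : z.freshPhase ≤ z.cycle := by
  have h1 := hz.waitPhase_nonneg
  have h2 := hz.sendPhase_nonneg
  rw [cycle]; linarith

/-- The first attempt starts at time `r`, and attempt `m` at the `m`-th update after `r`. -/
theorem attemptStart_eq {P : Path} {r : ℝ} {x : ℕ → ℝ}
    (h : Tracks P.updateTimes r x fun _ => True) (hx : GoodGaps x) (m : ℕ) :
    P.attemptStart r m = r + partialSum x m := by
  induction m with
  | zero => simp [Path.attemptStart]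
  | succ m ih =>
    rw [Path.attemptStart, ih, (h.shift hx m).nextAfter (hx.shift m) (n := 0) trivial (by simp),
      add_assoc, ← partialSum_add]

theorem deliveryTime_eq {P : Path} {j : ℕ} {r : ℝ} {x row : ℕ → ℝ}
    (h : Tracks P.updateTimes r x fun _ => True) (hx : GoodGaps x)
    (hrow : ∀ m, P.transmission j m = row m) :
    P.deliveryTime j r = r + transmissionDelay row x := by
  have hidx : P.lastAttempt j r = attemptIdx row x := by
    rw [Path.lastAttempt, attemptIdx]
    congr 1
    ext m
    simp only [Set.mem_ofPred_eq, attemptStart_eq h hx, hrow, partialSum_succ]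
    constructor <;> intro h <;> linarith
  rw [Path.deliveryTime, hidx, attemptStart_eq h hx, hrow, transmissionDelay]
  ring

theorem Governs.nextAfter_updateTimes {z : Future} {P : Path} {j : ℕ} {X : ℝ}
    (h : z.Governs P j X) (hz : z.Good) : nextAfter P.updateTimes X = X + z.freshPhase := by
  rw [h.updates.nextAfter hz.updates (n := 0) trivial (by simp), partialSum_succ, partialSum_zero,
    zero_add, freshPhase]

/-- The cycle that starts at time `X` has the phases that `z` prescribes, and the next one is
governed by `z.next`. -/
theorem Governs.cycle {z : Future} {P : Path} {j : ℕ} {X : ℝ} (h : z.Governs P j X)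
    (hz : z.Good) :
    P.deliveryTime j (nextAfter P.forwardedTimes (nextAfter P.updateTimes X)) = X + z.cycle ∧
      z.next.Governs P (j + 1) (X + z.cycle) := by
  have hout := hz.outdatedRequests
  have hfresh := h.nextAfter_updateTimes hz
  have hreq : Tracks P.forwardedTimes (X + z.freshPhase) z.outdatedRequests.1
      fun k => z.outdatedRequests.2 k = 1 := h.requests.residual hz.requests hz.freshPhase_pos.le
  obtain ⟨hmin, hn⟩ := (forwardIdx_eq_iff hout.2).1 rfl
  have hwait : nextAfter P.forwardedTimes (X + z.freshPhase) = X + z.freshPhase + z.waitPhase :=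
    hreq.nextAfter hout.1 hn hmin
  have hupd : Tracks P.updateTimes (X + z.freshPhase) (shift 1 z.2.1) fun _ => True := by
    have := h.updates.shift hz.updates 1
    rwa [partialSum_succ, partialSum_zero, zero_add] at this
  have hsend : Tracks P.updateTimes (X + z.freshPhase + z.waitPhase) z.sendUpdates fun _ => True :=
    hupd.residual (hz.updates.shift 1) hz.waitPhase_nonneg
  have hdrop : Tracks P.forwardedTimes (X + z.freshPhase + z.waitPhase)
      (dropForwarded z.outdatedRequests).1 fun k => (dropForwarded z.outdatedRequests).2 k = 1 :=
    hreq.shift hout.1 _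
  have hsum : X + z.cycle = X + z.freshPhase + z.waitPhase + z.sendPhase := by
    rw [Future.cycle]; ring
  refine ⟨?_, ?_, ?_, fun i m => ?_⟩
  · rw [hfresh, hwait, hsum]
    exact deliveryTime_eq hsend hz.sendUpdates fun m => h.transmission 0 m
  · rw [hsum]
    exact hsend.residual hz.sendUpdates hz.sendPhase_nonneg
  · rw [hsum]
    exact hdrop.residual (hout.1.shift _) hz.sendPhase_nonneg
  · rw [add_assoc]
    exact h.transmission (1 + i) m

variable {z : Future}

theorem governs_successTime (hz : ∀ j, (next^[j] z).Good) (j : ℕ) :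
    (next^[j] z).Governs z.toPath j (z.toPath.successTime j) := by
  induction j with
  | zero => exact (hz 0).governs_toPath
  | succ j ih =>
    have h := ih.cycle (hz j)
    rw [Path.successTime, h.1, Function.iterate_succ_apply']
    exact h.2

theorem successTime_succ (hz : ∀ j, (next^[j] z).Good) (j : ℕ) :
    z.toPath.successTime (j + 1) = z.toPath.successTime j + (next^[j] z).cycle :=
  ((governs_successTime hz j).cycle (hz j)).1

theorem successTime_eq (hz : ∀ j, (next^[j] z).Good) (n : ℕ) :
    z.toPath.successTime n = partialSum (fun j => (next^[j] z).cycle) n := by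
  induction n with
  | zero => rfl
  | succ n ih => rw [successTime_succ hz, ih, partialSum_succ]

theorem cycle_pos (hz : ∀ j, (next^[j] z).Good) (j : ℕ) : 0 < (next^[j] z).cycle :=
  (hz j).freshPhase_pos.trans_le (hz j).freshPhase_le_cycle

theorem cycleLength_eq (hz : ∀ j, (next^[j] z).Good) (j : ℕ) :
    z.toPath.cycleLength j = (next^[j] z).cycle := by
  rw [Path.cycleLength, successTime_succ hz]; ring

/-- Within a cycle the copy is fresh exactly until the first update. -/
theorem isFresh_iff (hz : ∀ j, (next^[j] z).Good) {j : ℕ} {t : ℝ}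
    (h1 : z.toPath.successTime j ≤ t) (h2 : t < z.toPath.successTime (j + 1)) :
    z.toPath.IsFresh t ↔ t < z.toPath.successTime j + (next^[j] z).freshPhase := by
  have hmono : StrictMono z.toPath.successTime :=
    strictMono_nat_of_lt_succ fun n => by
      rw [successTime_succ hz]; linarith [cycle_pos hz n]
  have htr := (governs_successTime hz j).updates
  have hps : partialSum (next^[j] z).2.1 1 = (next^[j] z).freshPhase := by
    rw [partialSum_succ, partialSum_zero, zero_add, freshPhase]
  constructor
  · rintro ⟨i, hi, hno⟩
    by_contra hlt
    have hij : i < j + 1 := hmono.lt_iff_lt.1 (hi.trans_lt h2)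
    have hle := hmono.monotone (Nat.lt_succ_iff.1 hij)
    have hmem := (htr (z.toPath.successTime j + (next^[j] z).freshPhase)).2
      ⟨0, trivial, by rw [zero_add, hps]⟩
    exact hno _ hmem.1 ⟨hle.trans_lt hmem.2, not_lt.1 hlt⟩
  · intro hlt
    refine ⟨j, h1, fun x hx hx' => ?_⟩
    obtain ⟨k, -, rfl⟩ := (htr x).1 ⟨hx, hx'.1⟩
    have := (partialSum_mono (hz j).updates.pos).monotone (show 1 ≤ k + 1 by omega)
    rw [hps] at this
    linarith [hx'.2]

theorem freshness_eq_indicator (hz : ∀ j, (next^[j] z).Good) {j : ℕ} {t : ℝ}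
    (ht : t ∈ Set.Ico (z.toPath.successTime j) (z.toPath.successTime (j + 1))) :
    z.toPath.freshness t = (Set.Ico (z.toPath.successTime j)
      (z.toPath.successTime j + (next^[j] z).freshPhase)).indicator 1 t := by
  classical
  have h := isFresh_iff hz ht.1 ht.2
  rw [Path.freshness, Set.indicator_apply]
  simp only [h, Set.mem_Ico, ht.1, true_and, Pi.one_apply]

theorem intervalIntegrable_freshness_cycle (hz : ∀ j, (next^[j] z).Good) (j : ℕ) :
    IntervalIntegrable z.toPath.freshness volume (z.toPath.successTime j)
      (z.toPath.successTime (j + 1)) := by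
  have hle : z.toPath.successTime j ≤ z.toPath.successTime (j + 1) := by
    rw [successTime_succ hz]; linarith [cycle_pos hz j]
  rw [intervalIntegrable_iff_integrableOn_Ico_of_le hle]
  refine (integrableOn_congr_fun (fun t ht => freshness_eq_indicator hz ht)
    measurableSet_Ico).2 ?_
  exact ((integrable_indicator_iff measurableSet_Ico).2
    (integrableOn_const (C := (1 : ℝ)) measure_Ico_lt_top.ne)).integrableOn

theorem freshDuration_eq (hz : ∀ j, (next^[j] z).Good) (j : ℕ) :
    z.toPath.freshDuration j = (next^[j] z).freshPhase := by
  have hle : z.toPath.successTime j ≤ z.toPath.successTime (j + 1) := by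
    rw [successTime_succ hz]; linarith [cycle_pos hz j]
  have hle' : z.toPath.successTime j + (next^[j] z).freshPhase ≤
      z.toPath.successTime (j + 1) := by
    rw [successTime_succ hz]; linarith [(hz j).freshPhase_le_cycle]
  rw [Path.freshDuration, intervalIntegral.integral_of_le hle, ← integral_Ico_eq_integral_Ioc,
    setIntegral_congr_fun measurableSet_Ico fun t ht => freshness_eq_indicator hz ht,
    setIntegral_indicator measurableSet_Ico,
    Set.inter_eq_right.2 (Set.Ico_subset_Ico_right hle')]
  simp [(hz j).freshPhase_pos.le]

theorem freshness_nonneg (P : Path) (t : ℝ) : 0 ≤ P.freshness t := by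
  unfold Path.freshness; split_ifs <;> norm_num

theorem integral_freshness_successTime (hz : ∀ j, (next^[j] z).Good) (n : ℕ) :
    ∫ t in (0 : ℝ)..z.toPath.successTime n, z.toPath.freshness t =
      partialSum (fun j => (next^[j] z).freshPhase) n := by
  have h := intervalIntegral.sum_integral_adjacent_intervals (n := n)
    (a := z.toPath.successTime) (f := z.toPath.freshness) (μ := volume)
    fun k _ => intervalIntegrable_freshness_cycle hz k
  rw [show (0 : ℝ) = z.toPath.successTime 0 from rfl, ← h]
  exact Finset.sum_congr rfl fun j _ => freshDuration_eq hz j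

theorem intervalIntegrable_freshness (hz : ∀ j, (next^[j] z).Good) (n : ℕ) :
    IntervalIntegrable z.toPath.freshness volume 0 (z.toPath.successTime n) :=
  IntervalIntegrable.trans_iterate (a := z.toPath.successTime)
    fun k _ => intervalIntegrable_freshness_cycle hz k

end Future

/-! ### The renewal reward argument -/

/-- If a monotone function takes the values `∑ i < n, R i` at the renewal epochs `∑ i < n, I i`,
then the averages of `R` and `I` determine its growth rate. -/
theorem tendsto_renewal_reward {I R : ℕ → ℝ} {F : ℝ → ℝ} {m l : ℝ} (hI : ∀ n, 0 < I n)
    (hl : 0 < l) (hF0 : ∀ n, 0 ≤ F (partialSum I n)) (hF : ∀ n, F (partialSum I n) = partialSum R n)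
    (hmono : ∀ n t, partialSum I n ≤ t → t ≤ partialSum I (n + 1) →
      F (partialSum I n) ≤ F t ∧ F t ≤ F (partialSum I (n + 1)))
    (hIl : Tendsto (fun n : ℕ => partialSum I n / n) atTop (𝓝 l))
    (hRm : Tendsto (fun n : ℕ => partialSum R n / n) atTop (𝓝 m)) :
    Tendsto (fun t : ℝ => (1 / t) * F t) atTop (𝓝 (m / l)) := by
  have hgood : GoodGaps I := by
    refine ⟨hI, ?_⟩
    refine (hIl.pos_mul_atTop hl tendsto_natCast_atTop_atTop).congr' ?_
    filter_upwards [eventually_gt_atTop 0] with n hn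
    have : (n : ℝ) ≠ 0 := by positivity
    field_simp
  have hcross : Tendsto (crossIdx I) atTop atTop := by
    refine tendsto_atTop.2 fun k => ?_
    filter_upwards [eventually_ge_atTop (partialSum I k)] with t ht
    have h1 := hgood.lt_partialSum_crossIdx t
    have := (partialSum_mono hI).lt_iff_lt.1 (ht.trans_lt h1)
    omega
  -- With `n` the index of the cycle that contains `t`, the quotient `F t / t` lies between
  -- `partialSum R n / partialSum I (n + 1)` and `partialSum R (n + 1) / partialSum I n`.
  have hone : Tendsto (fun n : ℕ => (n : ℝ) / (n + 1)) atTop (𝓝 1) := by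
    simpa using tendsto_natCast_div_add_atTop (1 : ℝ)
  have hIl1 := (tendsto_add_atTop_iff_nat 1).2 hIl
  have hRm1 := (tendsto_add_atTop_iff_nat 1).2 hRm
  have hlow : Tendsto (fun n : ℕ => partialSum R n / partialSum I (n + 1)) atTop (𝓝 (m / l)) := by
    have h := (hRm.mul hone).div hIl1 hl.ne'
    rw [mul_one] at h
    refine h.congr' ?_
    filter_upwards [eventually_gt_atTop 0] with n hn
    have h1 : (n : ℝ) ≠ 0 := by positivity
    have h2 : partialSum I (n + 1) ≠ 0 := ((partialSum_mono hI) (Nat.succ_pos n)).ne'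
    simp only [Pi.div_apply]
    push_cast
    field_simp
  have hupp : Tendsto (fun n : ℕ => partialSum R (n + 1) / partialSum I n) atTop (𝓝 (m / l)) := by
    have h := hRm1.div (hIl.mul hone) (by simpa using hl.ne')
    rw [mul_one] at h
    refine h.congr' ?_
    filter_upwards [eventually_gt_atTop 0] with n hn
    have h1 : (n : ℝ) ≠ 0 := by positivity
    have h2 : partialSum I n ≠ 0 := ((partialSum_mono hI) hn).ne'
    simp only [Pi.div_apply]
    push_cast
    field_simp
  refine tendsto_of_tendsto_of_tendsto_of_le_of_le' (hlow.comp hcross) (hupp.comp hcross) ?_ ?_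
  · filter_upwards [eventually_gt_atTop 0] with t ht
    have h1 := partialSum_crossIdx_le (x := I) ht.le
    have h2 := hgood.lt_partialSum_crossIdx t
    obtain ⟨h3, -⟩ := hmono _ t h1 h2.le
    rw [Function.comp_apply, ← hF, one_div_mul_eq_div]
    exact div_le_div₀ ((hF0 _).trans h3) h3 ht h2.le
  · filter_upwards [eventually_gt_atTop 0, hcross.eventually_gt_atTop 0] with t ht hpos
    have h1 := partialSum_crossIdx_le (x := I) ht.le
    have h2 := hgood.lt_partialSum_crossIdx t
    obtain ⟨-, h3⟩ := hmono _ t h1 h2.le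
    rw [Function.comp_apply, ← hF, one_div_mul_eq_div]
    exact div_le_div₀ (hF0 _) h3 ((partialSum_mono hI) hpos) h1

theorem Future.tendsto_average_freshness {z : Future} (hz : ∀ j, (next^[j] z).Good) {m l : ℝ}
    (hl : 0 < l)
    (hI : Tendsto (fun n : ℕ => partialSum (fun j => (next^[j] z).cycle) n / n) atTop (𝓝 l))
    (hT : Tendsto (fun n : ℕ => partialSum (fun j => (next^[j] z).freshPhase) n / n) atTop (𝓝 m)) :
    Tendsto (fun T : ℝ => (1 / T) * ∫ t in (0 : ℝ)..T, z.toPath.freshness t) atTop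
      (𝓝 (m / l)) := by
  have hint := intervalIntegrable_freshness hz
  have hval := integral_freshness_successTime hz
  simp only [successTime_eq hz] at hint hval
  have hX : ∀ n, 0 ≤ partialSum (fun j => (next^[j] z).cycle) n := fun n =>
    Finset.sum_nonneg fun j _ => (cycle_pos hz j).le
  refine tendsto_renewal_reward (F := fun T => ∫ t in (0 : ℝ)..T, z.toPath.freshness t)
    (cycle_pos hz) hl (fun n => ?_) hval (fun n t h1 h2 => ⟨?_, ?_⟩) hI hT
  · exact intervalIntegral.integral_nonneg (hX n) fun t _ => freshness_nonneg _ t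
  · refine intervalIntegral.integral_mono_interval le_rfl (hX n) h1
      (Eventually.of_forall fun t => freshness_nonneg _ t) ?_
    exact (hint (n + 1)).mono_set (Set.uIcc_subset_uIcc_left
      (Set.mem_uIcc_of_le ((hX n).trans h1) h2))
  · exact intervalIntegral.integral_mono_interval le_rfl ((hX n).trans h1) h2
      (Eventually.of_forall fun t => freshness_nonneg _ t) (hint (n + 1))

/-! ### From the primitive variables to the limit -/

/-- The law of the mark of a request, which is `1` with probability `p` and `0` otherwise. -/
noncomputable def markLaw (p : ℝ) : Measure ℝ :=
  ENNReal.ofReal p • Measure.dirac 1 + (1 - ENNReal.ofReal p) • Measure.dirac 0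

theorem markLaw_singleton_one (p : ℝ) : markLaw p {1} = ENNReal.ofReal p := by
  simp [markLaw]

theorem hasLaw_indicator {Ω : Type*} [MeasurableSpace Ω] {μ : Measure Ω} [IsProbabilityMeasure μ]
    {D : Set Ω} (hD : MeasurableSet D) {p : ℝ} (hp : μ D = ENNReal.ofReal p) :
    HasLaw (D.indicator fun _ => (1 : ℝ)) (markLaw p) μ := by
  have hm : Measurable (D.indicator fun _ => (1 : ℝ)) := measurable_const.indicator hD
  refine ⟨hm.aemeasurable, ?_⟩
  ext E hE
  have hDc : μ Dᶜ = 1 - ENNReal.ofReal p := by rw [prob_compl_eq_one_sub hD, hp]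
  rw [Measure.map_apply hm hE, ← measure_inter_add_sdiff _ hD, markLaw, Measure.add_apply,
    Measure.smul_apply, Measure.smul_apply, Measure.dirac_apply' _ hE, Measure.dirac_apply' _ hE,
    ← hDc, ← hp, smul_eq_mul, smul_eq_mul]
  congr 1
  · by_cases h : (1 : ℝ) ∈ E
    · rw [Set.indicator_of_mem h, Pi.one_apply, mul_one]
      congr 1
      ext ω
      simp only [Set.mem_inter_iff, Set.mem_preimage, and_iff_right_iff_imp]
      intro hω; rwa [Set.indicator_of_mem hω]
    · rw [Set.indicator_of_notMem h, mul_zero]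
      convert measure_empty (μ := μ)
      ext ω
      simp only [Set.mem_inter_iff, Set.mem_preimage, Set.mem_empty_iff_false, iff_false, not_and']
      intro hω; rwa [Set.indicator_of_mem hω]
  · by_cases h : (0 : ℝ) ∈ E
    · rw [Set.indicator_of_mem h, Pi.one_apply, mul_one]
      congr 1
      ext ω
      simp only [Set.mem_sdiff, Set.mem_preimage, Set.mem_compl_iff, and_iff_right_iff_imp]
      intro hω; rwa [Set.indicator_of_notMem hω]
    · rw [Set.indicator_of_notMem h, mul_zero]
      convert measure_empty (μ := μ)
      ext ω
      simp only [Set.mem_sdiff, Set.mem_preimage, Set.mem_empty_iff_false, iff_false, not_and']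
      intro hω; rwa [Set.indicator_of_notMem hω]

theorem isProbabilityMeasure_markLaw {p : ℝ} (hp : p ≤ 1) : IsProbabilityMeasure (markLaw p) := by
  refine ⟨?_⟩
  simp only [markLaw, Measure.add_apply, Measure.smul_apply, measure_univ, smul_eq_mul, mul_one]
  exact add_tsub_cancel_of_le (ENNReal.ofReal_le_one.2 hp)

/-- The future that is encoded in the family of all primitive variables. -/
def Future.ofFamily (x : ℕ ⊕ ℕ ⊕ ℕ ⊕ ℕ × ℕ → ℝ) : Future :=
  ((fun n => x (.inr (.inl n)), fun n => x (.inr (.inr (.inl n)))),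
    (fun n => x (.inl n), fun j m => x (.inr (.inr (.inr (j, m))))))

theorem Future.measurable_ofFamily : Measurable Future.ofFamily := by
  unfold Future.ofFamily; fun_prop

section

variable {lam u s : ℝ} [IsProbabilityMeasure (expMeasure lam)]
  [IsProbabilityMeasure (expMeasure u)] [IsProbabilityMeasure (expMeasure s)]
  {κ : Measure ℝ} [IsProbabilityMeasure κ]

/-- Independence of all primitive variables means that the future at time `0` has the law
`futureLaw`. -/
theorem hasLaw_future {Ω : Type*} [MeasurableSpace Ω] {μ : Measure Ω} [IsProbabilityMeasure μ]
    {A B M : ℕ → Ω → ℝ} {S : ℕ → ℕ → Ω → ℝ}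
    (hA : ∀ n, HasLaw (A n) (expMeasure lam) μ) (hB : ∀ n, HasLaw (B n) (expMeasure u) μ)
    (hM : ∀ n, HasLaw (M n) κ μ) (hS : ∀ j m, HasLaw (S j m) (expMeasure s) μ)
    (hindep : iIndepFun
      (Sum.elim A (Sum.elim B (Sum.elim M fun q : ℕ × ℕ => S q.1 q.2))) μ) :
    HasLaw (fun ω => (((fun n => B n ω, fun n => M n ω), (fun n => A n ω, fun j m => S j m ω)) :
      Future)) (futureLaw lam u s κ) μ := by
  set ν₃ : ℕ ⊕ ℕ × ℕ → Measure ℝ := Sum.elim (fun _ => κ) (fun _ => expMeasure s)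
  set ν₂ : ℕ ⊕ ℕ ⊕ ℕ × ℕ → Measure ℝ := Sum.elim (fun _ => expMeasure u) ν₃
  set ν₁ : ℕ ⊕ ℕ ⊕ ℕ ⊕ ℕ × ℕ → Measure ℝ := Sum.elim (fun _ => expMeasure lam) ν₂
  have i₃ : ∀ i, IsProbabilityMeasure (ν₃ i) := by
    rintro (i | i) <;> simp only [ν₃, Sum.elim_inl, Sum.elim_inr] <;> infer_instance
  have i₂ : ∀ i, IsProbabilityMeasure (ν₂ i) := by
    rintro (i | i) <;> simp only [ν₂, Sum.elim_inl, Sum.elim_inr] <;> infer_instance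
  have i₁ : ∀ i, IsProbabilityMeasure (ν₁ i) := by
    rintro (i | i) <;> simp only [ν₁, Sum.elim_inl, Sum.elim_inr] <;> infer_instance
  have hlaw : ∀ i, HasLaw
      (Sum.elim A (Sum.elim B (Sum.elim M fun q : ℕ × ℕ => S q.1 q.2)) i) (ν₁ i) μ := by
    rintro (i | i | i | i)
    · exact hA i
    · exact hB i
    · exact hM i
    · exact hS i.1 i.2
  have hjoint := hindep.hasLaw_infinitePi hlaw
    (aemeasurable_pi_iff.2 fun i => (hlaw i).aemeasurable)
  have hsum := (measurePreserving_sumElim (fun _ => expMeasure lam) ν₂).comp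
    ((MeasurePreserving.id (iidLaw (expMeasure lam))).prod
      ((measurePreserving_sumElim (fun _ => expMeasure u) ν₃).comp
        ((MeasurePreserving.id (iidLaw (expMeasure u))).prod
          (measurePreserving_sumElim (fun _ : ℕ => κ) (fun _ : ℕ × ℕ => expMeasure s)))))
  have hcurry : MeasurePreserving (MeasurableEquiv.curry ℕ ℕ ℝ)
      (Measure.infinitePi fun _ : ℕ × ℕ => expMeasure s) (iidLaw (iidLaw (expMeasure s))) :=
    ⟨by fun_prop, Measure.infinitePi_map_curry fun _ _ => expMeasure s⟩
  have hfuture := ((MeasurePreserving.id (requestLaw u κ)).prod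
      ((MeasurePreserving.id (iidLaw (expMeasure lam))).prod hcurry)).comp
    ((measurePreserving_left_comm _ _ _).comp
      ((MeasurePreserving.id (iidLaw (expMeasure lam))).prod (measurePreserving_assoc_symm
        (iidLaw (expMeasure u)) (iidLaw κ)
        (Measure.infinitePi fun _ : ℕ × ℕ => expMeasure s))))
  have hof : MeasurePreserving Future.ofFamily (Measure.infinitePi ν₁) (futureLaw lam u s κ) := by
    refine ⟨Future.measurable_ofFamily, ?_⟩
    rw [← hsum.map_eq, Measure.map_map Future.measurable_ofFamily hsum.measurable]
    exact hfuture.map_eq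
  exact ⟨hof.measurable.comp_aemeasurable hjoint.aemeasurable, by
    rw [← hof.map_eq, ← hjoint.map_eq]
    exact (AEMeasurable.map_map_of_aemeasurable hof.measurable.aemeasurable
      hjoint.aemeasurable).symm⟩

theorem ae_good (hlam : 0 < lam) (hu : 0 < u) (hs : 0 < s) (hκ : κ {1} ≠ 0) :
    ∀ᵐ z ∂futureLaw lam u s κ, ∀ j, (Future.next^[j] z).Good := by
  refine ae_all_iff.2 fun j =>
    ((measurePreserving_next κ hlam hu hs hκ).iterate j).quasiMeasurePreserving.ae ?_
  have hrow : ∀ᵐ σ ∂iidLaw (iidLaw (expMeasure s)), ∀ m, 0 < σ 0 m :=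
    (measurePreserving_eval_infinitePi (fun _ => iidLaw (expMeasure s))
      0).quasiMeasurePreserving.ae (ae_all_iff.2 fun m =>
        (measurePreserving_eval_infinitePi (fun _ => expMeasure s)
          m).quasiMeasurePreserving.ae (expMeasure_ae_pos s))
  filter_upwards [
    Measure.quasiMeasurePreserving_snd.ae (Measure.quasiMeasurePreserving_fst.ae
      (ae_goodGaps hlam)),
    Measure.quasiMeasurePreserving_fst.ae (Measure.quasiMeasurePreserving_fst.ae
      (ae_goodGaps hu)),
    Measure.quasiMeasurePreserving_fst.ae (ae_frequently_forwarded (u := u) κ hκ),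
    Measure.quasiMeasurePreserving_snd.ae (Measure.quasiMeasurePreserving_snd.ae hrow)]
    with z h1 h2 h3 h4
  exact ⟨h1, h2, h3, h4⟩

/-- The strong law of large numbers for a function of the phases of the successive cycles. -/
theorem strong_law_phases (hlam : 0 < lam) (hu : 0 < u) (hs : 0 < s) (hκ : κ {1} ≠ 0)
    {f : (ℝ × ℝ) × ℝ → ℝ} (hf : Measurable f) (hint : Integrable f (phaseLaw lam u s κ)) :
    ∀ᵐ z ∂futureLaw lam u s κ, Tendsto
      (fun n : ℕ => partialSum (fun j => f (Future.next^[j] z).phases) n / n) atTop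
      (𝓝 (∫ t, f t ∂phaseLaw lam u s κ)) := by
  have hph := measurePreserving_phases κ hlam hu hs hκ
  have h := strong_law_ae_real (μ := futureLaw lam u s κ)
    (fun j z => f (Future.next^[j] z).phases) (hph.integrable_comp_of_integrable hint)
    (fun i j hij => by
      rcases lt_or_gt_of_ne hij with h | h
      · exact indepFun_phases κ hlam hu hs hκ hf h
      · exact (indepFun_phases κ hlam hu hs hκ hf h).symm)
    (fun i => identDistrib_phases κ hlam hu hs hκ hf i)
  rw [← hph.map_eq, integral_map hph.measurable.aemeasurable hf.aestronglyMeasurable]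
  exact h

theorem integral_phases (hlam : 0 < lam) (hu : 0 < u) (hs : 0 < s) (hκ : κ {1} ≠ 0)
    {f : (ℝ × ℝ) × ℝ → ℝ} (hf : Measurable f) (hint : Integrable f (phaseLaw lam u s κ)) (j : ℕ) :
    Integrable (fun z => f (Future.next^[j] z).phases) (futureLaw lam u s κ) ∧
      ∫ z, f (Future.next^[j] z).phases ∂futureLaw lam u s κ =
        ∫ t, f t ∂phaseLaw lam u s κ := by
  have hph := (measurePreserving_phases κ hlam hu hs hκ).comp
    ((measurePreserving_next κ hlam hu hs hκ).iterate j)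
  refine ⟨hph.integrable_comp_of_integrable hint, ?_⟩
  conv_rhs => rw [← hph.map_eq]
  rw [integral_map hph.measurable.aemeasurable hf.aestronglyMeasurable]
  rfl

end

theorem integrable_and_integral_of_hasLaw {Ω V : Type*} [MeasurableSpace Ω] [MeasurableSpace V]
    {μ : Measure Ω} {ν : Measure V} {Z : Ω → V} (hZ : HasLaw Z ν μ) {f g : V → ℝ}
    (hg : Integrable g ν) (hfg : f =ᵐ[ν] g) :
    Integrable (fun ω => f (Z ω)) μ ∧ ∫ ω, f (Z ω) ∂μ = ∫ v, g v ∂ν := by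
  have hf : Integrable f ν := hg.congr hfg.symm
  rw [← hZ.map_eq] at hf
  refine ⟨hf.comp_aemeasurable hZ.aemeasurable, ?_⟩
  rw [← integral_congr_ae hfg, ← hZ.map_eq,
    integral_map hZ.aemeasurable hf.aestronglyMeasurable]

end CacheUpdating

theorem theorem2 {Ω : Type*} [MeasurableSpace Ω] (μ : Measure Ω) [IsProbabilityMeasure μ]
    (lam u c s : ℝ) (hlam : 0 < lam) (hc : 0 < c) (hcu : c ≤ u) (hs : 0 < s)
    (A B : ℕ → Ω → ℝ) (D : ℕ → Set Ω) (S : ℕ → ℕ → Ω → ℝ)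
    (hA : ∀ n, HasLaw (A n) (expMeasure lam) μ)
    (hB : ∀ n, HasLaw (B n) (expMeasure u) μ)
    (hD : ∀ n, MeasurableSet (D n)) (hDp : ∀ n, μ (D n) = ENNReal.ofReal (c / u))
    (hS : ∀ j m, HasLaw (S j m) (expMeasure s) μ)
    (hindep : iIndepFun
      (Sum.elim A (Sum.elim B (Sum.elim (fun n => (D n).indicator (fun _ => (1 : ℝ)))
        (fun q : ℕ × ℕ => S q.1 q.2)))) μ) :
    (∀ᵐ ω ∂μ, Tendsto (fun T : ℝ => (1 / T) * ∫ t in (0 : ℝ)..T, (path A B D S ω).freshness t)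
      atTop (𝓝 (c / (c + lam + c * lam / s)))) ∧
    ∀ j : ℕ,
      Integrable (fun ω => (path A B D S ω).freshDuration j) μ ∧
      Integrable (fun ω => (path A B D S ω).cycleLength j) μ ∧
      ∫ ω, (path A B D S ω).freshDuration j ∂μ = 1 / lam ∧
      ∫ ω, (path A B D S ω).cycleLength j ∂μ = 1 / lam + 1 / c + 1 / s ∧
      (∫ ω, (path A B D S ω).freshDuration j ∂μ) / (∫ ω, (path A B D S ω).cycleLength j ∂μ)
        = c / (c + lam + c * lam / s) := by
  have hu : 0 < u := hc.trans_le hcu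
  have := isProbabilityMeasure_expMeasure hlam
  have := isProbabilityMeasure_expMeasure hu
  have := isProbabilityMeasure_expMeasure hs
  have := isProbabilityMeasure_markLaw ((div_le_one hu).2 hcu)
  have hκ := markLaw_singleton_one (c / u)
  have hκ0 : markLaw (c / u) {1} ≠ 0 := by
    rw [hκ]; simpa using div_pos hc hu
  have hZ := hasLaw_future hA hB (fun n => hasLaw_indicator (hD n) (hDp n)) hS hindep
  set Z : Ω → Future := fun ω => ((fun n => B n ω, fun n => (D n).indicator (fun _ => (1 : ℝ)) ω),
    (fun n => A n ω, fun j m => S j m ω))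
  have hpath : ∀ ω, path A B D S ω = (Z ω).toPath := by
    intro ω
    simp only [path, Future.toPath, Z]
    congr 1
    funext n
    simp
  have hgood := ae_good (s := s) hlam hu hs hκ0
  obtain ⟨iT, eT⟩ := mean_freshPhase (s := s) (markLaw (c / u)) hlam hu
  obtain ⟨iI, eI⟩ := mean_cycle (markLaw (c / u)) hlam hu hs hc hκ
  -- The quotient of the two means is the claimed limit.
  have hratio : (1 / lam) / (1 / lam + 1 / c + 1 / s) = c / (c + lam + c * lam / s) := by
    have h1 : 1 / lam + 1 / c + 1 / s ≠ 0 := by positivity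
    have h2 : c + lam + c * lam / s ≠ 0 := by positivity
    rw [div_eq_div_iff h1 h2]
    field_simp
  simp only [hpath]
  refine ⟨?_, fun j => ?_⟩
  · refine ae_of_ae_map (p := fun z : Future => Tendsto
      (fun T : ℝ => (1 / T) * ∫ t in (0 : ℝ)..T, z.toPath.freshness t) atTop
      (𝓝 (c / (c + lam + c * lam / s)))) hZ.aemeasurable ?_
    rw [hZ.map_eq]
    filter_upwards [hgood,
      strong_law_phases hlam hu hs hκ0 (f := fun t => t.1.1) (by fun_prop) iT,
      strong_law_phases hlam hu hs hκ0 (f := fun t => t.1.1 + t.1.2 + t.2) (by fun_prop) iI]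
      with z hz hT hI
    rw [eT] at hT
    rw [eI] at hI
    rw [← hratio]
    exact Future.tendsto_average_freshness hz (by positivity) hI hT
  · obtain ⟨jT, kT⟩ := integral_phases hlam hu hs hκ0 (f := fun t => t.1.1) (by fun_prop) iT j
    obtain ⟨jI, kI⟩ := integral_phases hlam hu hs hκ0 (f := fun t => t.1.1 + t.1.2 + t.2)
      (by fun_prop) iI j
    obtain ⟨aT, bT⟩ := integrable_and_integral_of_hasLaw hZ jT
      (hgood.mono fun z hz => Future.freshDuration_eq hz j)
    obtain ⟨aI, bI⟩ := integrable_and_integral_of_hasLaw hZ jI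
      (hgood.mono fun z hz => Future.cycleLength_eq hz j)
    rw [kT, eT] at bT
    rw [kI, eI] at bI
    exact ⟨aT, aI, bT, bI, by rw [bT, bI, hratio]⟩
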